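/- Let $\mathrm{Homeo}(S^1)$ be the group of all homeomorphisms of the circle $S^1$ under composition, with the topology of uniform convergence, let $G\subset\mathrm{Homeo}(S^1)$ be a sub-semigroup with the induced topology, and let $\nu$ be a Borel probability measure on $G$. Put $(\Omega,\mathbb P)=(G^{\mathbb N},\nu^{\mathbb N})$ and, for $\omega=(f_n)_{n\ge 0}\in\Omega$, $f_\omega^n=f_{n-1}\circ\cdots\circ f_0$ (with $f_\omega^0=\mathrm{id}$). Assume that: (i) $\nu$ is non-degenerate on $G$: the semigroup generated by the topological support of $\nu$ is dense in $G$; (ii) no Borel probability measure $\mu$ on $S^1$ satisfies $g_*\mu=\mu$ for all $g\in G$; (iii) the random walk is indecomposable: there do not exist an integer $p\ge 2$ and pairwise disjoint nonempty closed sets $F_1,\dots,F_p\subset S^1$ such that, for $\nu$-almost every $g$, $g(F_i)\subset F_{i+1}$ for $1\le i\le p-1$ and $g(F_p)\subset F_1$. For $x\in S^1$ let $\mu_n^x$ be the law of the random variable $\omega\mapsto f_\omega^n(x)$. A Borel probability measure $\mu$ on $S^1$ is called stationary if $\mathbb P\otimes\mu$ is invariant under the skew product $(\omega,x)\mapsto(T\omega,f_0(x))$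 of $\Omega\times S^1$, where $T$ is the shift on $\Omega$ and $f_0$ is the first coordinate of $\omega$. Then for every $x\in S^1$ there is a stationary probability measure $\mu^x$ on $S^1$ such that $\mu_n^x\to\mu^x$ weakly as $n\to\infty$. Moreover, the convergence is uniform in $x$ in the sense that for every continuous $\varphi:S^1\to\mathbb R$, $$\sup_{x\in S^1}\left|\int_{S^1}\varphi\,d\mu_n^x-\int_{S^1}\varphi\,d\mu^x\right|\xrightarrow[n\to\infty]{}0 .$$ -/

import Mathlib

open MeasureTheory Filter Topology

namespace CircleWalk

/-- The circle `S¹ = ℝ/ℤ`. -/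
abbrev S1 : Type := UnitAddCircle

/-- `Homeo(S¹)`: the group, under composition, of all homeomorphisms of the circle. -/
abbrev HomeoS1 : Type := S1 ≃ₜ S1

/-- The topology of uniform convergence (compact-open topology) on `Homeo(S¹)`. -/
noncomputable instance instTopologicalSpaceHomeoS1 : TopologicalSpace HomeoS1 :=
  TopologicalSpace.induced (fun f : HomeoS1 => (⟨f, f.continuous⟩ : C(S1, S1)))
    inferInstance

/-- `Homeo(S¹)` carries its Borel σ-algebra. -/
noncomputable instance instMeasurableSpaceHomeoS1 : MeasurableSpace HomeoS1 := borel HomeoS1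

instance instBorelSpaceHomeoS1 : BorelSpace HomeoS1 := ⟨rfl⟩

instance instSecondCountableTopologyHomeoS1 : SecondCountableTopology HomeoS1 :=
  TopologicalSpace.secondCountableTopology_induced _ _ _

/-- The random walk `f_ω^n = f_{n-1} ∘ ⋯ ∘ f_0`, for `ω = (f_n)` a sequence in `G`
(with `f_ω^0 = id`, which need not belong to `G`). -/
noncomputable def walk {G : Subsemigroup HomeoS1} (ω : ℕ → G) : ℕ → HomeoS1
  | 0 => 1
  | n + 1 => (ω n : HomeoS1) * walk ω n

/-- The probability `ℙ = ν^ℕ` on `Ω = G^ℕ`. -/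
noncomputable def pathMeasure {G : Subsemigroup HomeoS1} (ν : Measure G) : Measure (ℕ → G) :=
  Measure.infinitePi (fun _ : ℕ => ν)

instance instIsProbabilityMeasurePathMeasure {G : Subsemigroup HomeoS1} (ν : Measure G)
    [IsProbabilityMeasure ν] : IsProbabilityMeasure (pathMeasure ν) := by
  unfold pathMeasure; infer_instance

/-- `ν` is non-degenerate on `G`: the semigroup generated by the topological support of `ν`
is dense in `G`. -/
def NonDegenerate {G : Subsemigroup HomeoS1} (ν : Measure G) : Prop :=
  Dense (Subsemigroup.closure ν.support : Set G)

/-- `G` preserves the measure `μ`. -/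
def Preserves (G : Subsemigroup HomeoS1) (μ : Measure S1) : Prop :=
  ∀ g ∈ G, μ.map g = μ

/-- The random walk generated by `ν` is indecomposable: there is no cycle of `p ≥ 2` pairwise
disjoint nonempty closed sets `F_i`, indexed by `ℤ/pℤ`, such that `ν`-almost every `g`
maps each `F_i` into `F_{i+1}`. -/
def Indecomposable {G : Subsemigroup HomeoS1} (ν : Measure G) : Prop :=
  ¬ ∃ (p : ℕ) (F : ZMod p → Set S1), 2 ≤ p ∧
    (∀ i, IsClosed (F i)) ∧ (∀ i, (F i).Nonempty) ∧
    (∀ i j, i ≠ j → Disjoint (F i) (F j)) ∧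
    ∀ᵐ g : G ∂ν, ∀ i, (g : HomeoS1) '' F i ⊆ F (i + 1)

/-- The skew product `(ω, x) ↦ (Tω, f_0(x))`, with `T` the shift and `f_0` the first
coordinate of `ω`. -/
noncomputable def skewProduct (G : Subsemigroup HomeoS1) : (ℕ → G) × S1 → (ℕ → G) × S1 :=
  fun q => (fun n => q.1 (n + 1), (q.1 0 : HomeoS1) q.2)

/-- `μ` is stationary: `ℙ ⊗ μ` is invariant under the skew product. -/
def IsStationary {G : Subsemigroup HomeoS1} (ν : Measure G) (μ : Measure S1) : Prop :=
  MeasurePreserving (skewProduct G) ((pathMeasure ν).prod μ) ((pathMeasure ν).prod μ)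

theorem continuous_eval : Continuous (fun q : HomeoS1 × S1 => q.1 q.2) := by
  have h : Continuous (fun f : HomeoS1 => (⟨f, f.continuous⟩ : C(S1, S1))) :=
    continuous_induced_dom
  have h' : Continuous (fun p : C(S1, S1) × S1 => p.1 p.2) := ContinuousEval.continuous_eval
  exact h'.comp (h.prodMap continuous_id)

theorem measurable_walk_apply {G : Subsemigroup HomeoS1} (n : ℕ) (x : S1) :
    Measurable (fun ω : ℕ → G => walk ω n x) := by
  induction n with
  | zero => exact measurable_const
  | succ n ih =>
    exact continuous_eval.measurable.comp
      ((measurable_subtype_coe.comp (measurable_pi_apply n)).prodMk ih)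

/-- The law `μ_n^x` of the random variable `ω ↦ f_ω^n(x)`. -/
noncomputable def law {G : Subsemigroup HomeoS1} (ν : Measure G) [IsProbabilityMeasure ν]
    (n : ℕ) (x : S1) : ProbabilityMeasure S1 :=
  ⟨(pathMeasure ν).map (fun ω => walk ω n x),
    Measure.isProbabilityMeasure_map (measurable_walk_apply n x).aemeasurable⟩

end CircleWalk

set_option linter.unusedSectionVars false

/-! Let `P φ (x) = ∫ φ (g x) dν(g)`; then `∫ φ dμ_n^x = (P^n φ)(x)`, so the claim is that `P^n φ`
converges uniformly and that the limits are integrals against stationary measures.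

Equicontinuity. The expected distance of the images of `x` and `y` is at most the expected length of
the image of an arc containing both, that is, the mass of this arc under `lam ν n`, the Lebesgue
measure pushed by the inverse walk. Limits of these measures have no atoms: otherwise the atoms of
maximal mass form finite sets permuted by almost every `g`, which yields an invariant measure. Hence
short arcs have uniformly small mass and the iterates `P^n φ` are equicontinuous
(`exists_equicontinuity`).

Reduction. By Arzelà–Ascoli some subsequence of `P^n φ` converges to a function `ψ`, and `ψ` is
recurrent under `P`. Since `P` is a contraction, `P ψ = ψ` suffices for convergence of the whole
sequence.

Recurrent functions are fixed (`IsRecurrent.avg_eq`). On a minimal set `K` the `L²` norm of `P^n ψ`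
for a stationary measure cannot drop, so all variances vanish and `P^n ψ (g x) = P^(n+1) ψ (x)`.
Hence `P^n ψ` agrees at proximal points. Among three close points of `K` two are proximal
(`exists_proximal_pair`), so along an orbit `n ↦ P^n ψ (x)` is periodic; a period `p ≥ 2` would
decompose the walk. A maximum principle passes from minimal sets to the circle.

Proximality. Collapse the circle along an atomless measure `m` stationary for the inverse walk. For
an arc of mass `τ`, `τ (1 - τ)` is superharmonic, and its defect is the variance of the mass of the
image arc. Non-proximal triples at every scale would give, by minimisation, arbitrarily short
configurations rigid under all words; chaining them makes the words nonexpanding on the collapsed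
circle, hence `m` invariant. -/

namespace CircleWalk

/-! ### The averaging operator, its dual on measures, and Cesàro limits. -/

section Averaging

variable {E X : Type*} [TopologicalSpace E] [SecondCountableTopology E] [MeasurableSpace E]
  [BorelSpace E] [MetricSpace X] [CompactSpace X] [MeasurableSpace X] [BorelSpace X]

theorem integrable_of_continuous (μ : Measure X) [IsFiniteMeasure μ] (φ : C(X, ℝ)) :
    Integrable φ μ :=
  φ.continuous.integrable_of_hasCompactSupport (HasCompactSupport.of_compactSpace _)

theorem integrable_slice (ν : Measure E) [IsFiniteMeasure ν] (a : C(E × X, X)) (φ : C(X, ℝ))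
    (x : X) : Integrable (fun g => φ (a (g, x))) ν := by
  refine Integrable.of_bound (C := ‖φ‖) ?_ (ae_of_all _ fun g => φ.norm_coe_le_norm _)
  exact (φ.continuous.comp (a.continuous.comp (by fun_prop))).aestronglyMeasurable

/-- The averaging (Markov) operator of a random continuous map. -/
noncomputable def avg (ν : Measure E) [IsFiniteMeasure ν] (a : C(E × X, X)) (φ : C(X, ℝ)) :
    C(X, ℝ) where
  toFun x := ∫ g, φ (a (g, x)) ∂ν
  continuous_toFun := by
    refine continuous_of_dominated (bound := fun _ => ‖φ‖)
      (fun x => (integrable_slice ν a φ x).aestronglyMeasurable)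
      (fun x => ae_of_all _ fun _ => φ.norm_coe_le_norm _) (integrable_const _)
      (ae_of_all _ fun _ => φ.continuous.comp (a.continuous.comp (by fun_prop)))

variable (ν : Measure E) [IsProbabilityMeasure ν] (a : C(E × X, X))

theorem avg_apply (φ : C(X, ℝ)) (x : X) : avg ν a φ x = ∫ g, φ (a (g, x)) ∂ν := rfl

theorem avg_mono {φ ψ : C(X, ℝ)} (h : φ ≤ ψ) : avg ν a φ ≤ avg ν a ψ := fun x =>
  integral_mono (integrable_slice ν a φ x) (integrable_slice ν a ψ x) fun _ => h _

theorem avg_add (φ ψ : C(X, ℝ)) : avg ν a (φ + ψ) = avg ν a φ + avg ν a ψ := by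
  ext x
  exact integral_add (integrable_slice ν a φ x) (integrable_slice ν a ψ x)

theorem avg_sub (φ ψ : C(X, ℝ)) : avg ν a (φ - ψ) = avg ν a φ - avg ν a ψ := by
  ext x
  exact integral_sub (integrable_slice ν a φ x) (integrable_slice ν a ψ x)

theorem avg_smul (c : ℝ) (φ : C(X, ℝ)) : avg ν a (c • φ) = c • avg ν a φ := by
  ext x
  exact integral_const_mul c _

theorem avg_const (c : ℝ) : avg ν a (ContinuousMap.const X c) = ContinuousMap.const X c := by
  ext x
  simp [avg_apply]

theorem abs_avg_le (φ : C(X, ℝ)) (x : X) : |avg ν a φ x| ≤ ∫ g, |φ (a (g, x))| ∂ν :=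
  abs_integral_le_integral_abs

theorem norm_avg_le (φ : C(X, ℝ)) : ‖avg ν a φ‖ ≤ ‖φ‖ := by
  rw [ContinuousMap.norm_le _ (norm_nonneg _)]
  intro x
  refine (norm_integral_le_of_norm_le_const (C := ‖φ‖)
    (ae_of_all _ fun g => φ.norm_coe_le_norm _)).trans ?_
  simp

theorem iterate_avg_mono {φ ψ : C(X, ℝ)} (h : φ ≤ ψ) (n : ℕ) :
    (avg ν a)^[n] φ ≤ (avg ν a)^[n] ψ :=
  Monotone.iterate (fun _ _ => avg_mono ν a) n h

theorem iterate_avg_add (φ ψ : C(X, ℝ)) (n : ℕ) :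
    (avg ν a)^[n] (φ + ψ) = (avg ν a)^[n] φ + (avg ν a)^[n] ψ := by
  induction n generalizing φ ψ with
  | zero => rfl
  | succ n ih => simp [avg_add, ih]

theorem iterate_avg_sub (φ ψ : C(X, ℝ)) (n : ℕ) :
    (avg ν a)^[n] (φ - ψ) = (avg ν a)^[n] φ - (avg ν a)^[n] ψ := by
  induction n generalizing φ ψ with
  | zero => rfl
  | succ n ih => simp [avg_sub, ih]

theorem iterate_avg_smul (c : ℝ) (φ : C(X, ℝ)) (n : ℕ) :
    (avg ν a)^[n] (c • φ) = c • (avg ν a)^[n] φ := by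
  induction n generalizing φ with
  | zero => rfl
  | succ n ih => simp [avg_smul, ih]

theorem iterate_avg_const (c : ℝ) (n : ℕ) :
    (avg ν a)^[n] (ContinuousMap.const X c) = ContinuousMap.const X c :=
  Function.iterate_fixed (avg_const ν a c) n

theorem norm_iterate_avg_le (φ : C(X, ℝ)) (n : ℕ) : ‖(avg ν a)^[n] φ‖ ≤ ‖φ‖ := by
  induction n generalizing φ with
  | zero => rfl
  | succ n ih =>
    rw [Function.iterate_succ_apply]
    exact (ih _).trans (norm_avg_le ν a φ)

theorem dist_iterate_avg_le (φ ψ : C(X, ℝ)) (n : ℕ) :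
    dist ((avg ν a)^[n] φ) ((avg ν a)^[n] ψ) ≤ dist φ ψ := by
  rw [dist_eq_norm, dist_eq_norm, ← iterate_avg_sub]
  exact norm_iterate_avg_le ν a _ n

/-- The action of the random map on measures. -/
noncomputable def push (μ : ProbabilityMeasure X) : ProbabilityMeasure X :=
  ⟨(ν.prod (μ : Measure X)).map a,
    Measure.isProbabilityMeasure_map a.continuous.measurable.aemeasurable⟩

theorem coe_push (μ : ProbabilityMeasure X) :
    (push ν a μ : Measure X) = (ν.prod (μ : Measure X)).map a := rfl

theorem integral_push (μ : ProbabilityMeasure X) (φ : C(X, ℝ)) :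
    ∫ x, φ x ∂(push ν a μ : Measure X) = ∫ x, avg ν a φ x ∂(μ : Measure X) := by
  have hm : AEStronglyMeasurable (fun q : E × X => φ (a q)) (ν.prod (μ : Measure X)) :=
    (φ.continuous.comp a.continuous).aestronglyMeasurable
  rw [coe_push, integral_map a.continuous.measurable.aemeasurable
    φ.continuous.aestronglyMeasurable]
  exact integral_prod_symm _ (Integrable.of_bound (C := ‖φ‖) hm
    (ae_of_all _ fun g => φ.norm_coe_le_norm _))

theorem push_apply (μ : ProbabilityMeasure X) {A : Set X} (hA : MeasurableSet A) :
    (push ν a μ : Measure X) A = ∫⁻ g, (μ : Measure X) {x | a (g, x) ∈ A} ∂ν := by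
  rw [coe_push, Measure.map_apply a.continuous.measurable hA,
    Measure.prod_apply (a.continuous.measurable hA)]
  rfl

theorem probabilityMeasure_ext {μ η : ProbabilityMeasure X}
    (h : ∀ φ : C(X, ℝ), ∫ x, φ x ∂(μ : Measure X) = ∫ x, φ x ∂(η : Measure X)) : μ = η := by
  have : (μ : Measure X) = (η : Measure X) :=
    ext_of_forall_integral_eq_of_IsFiniteMeasure fun f => h f.toContinuousMap
  exact Subtype.ext this

theorem tendsto_probabilityMeasure_iff {ι : Type*} {l : Filter ι} {μs : ι → ProbabilityMeasure X}
    {μ : ProbabilityMeasure X} : Tendsto μs l (𝓝 μ) ↔ ∀ φ : C(X, ℝ),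
      Tendsto (fun i => ∫ x, φ x ∂(μs i : Measure X)) l (𝓝 (∫ x, φ x ∂(μ : Measure X))) := by
  rw [ProbabilityMeasure.tendsto_iff_forall_integral_tendsto]
  exact ⟨fun h φ => h (BoundedContinuousFunction.mkOfCompact φ), fun h f => h f.toContinuousMap⟩

theorem continuous_push : Continuous (push ν a : ProbabilityMeasure X → ProbabilityMeasure X) := by
  rw [continuous_iff_continuousAt]
  intro μ
  refine tendsto_probabilityMeasure_iff.2 fun φ => ?_
  simp only [integral_push]
  exact tendsto_probabilityMeasure_iff.1 tendsto_id _

theorem integral_mem_bounds (μ : ProbabilityMeasure X) (φ : C(X, ℝ)) :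
    |∫ x, φ x ∂(μ : Measure X)| ≤ ‖φ‖ := by
  refine (norm_integral_le_of_norm_le_const (C := ‖φ‖)
    (ae_of_all _ fun g => φ.norm_coe_le_norm _)).trans ?_
  simp

/-- Cesàro averages of a sequence of probability measures converge along an ultrafilter. -/
theorem exists_cesaro_limit [Nonempty X] (ρ : ℕ → ProbabilityMeasure X) :
    ∃ μ : ProbabilityMeasure X, ∀ φ : C(X, ℝ),
      Tendsto (fun n : ℕ => (∑ k ∈ Finset.range n, ∫ x, φ x ∂(ρ k : Measure X)) / n)
        (hyperfilter ℕ : Filter ℕ) (𝓝 (∫ x, φ x ∂(μ : Measure X))) := by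
  have hprob : ∀ n : ℕ, IsProbabilityMeasure
      (((n + 1 : ℕ) : ENNReal)⁻¹ • ∑ k ∈ Finset.range (n + 1), (ρ k : Measure X)) := by
    intro n
    refine ⟨?_⟩
    simp only [Measure.smul_apply, Measure.coe_finsetSum, Finset.sum_apply, measure_univ,
      Finset.sum_const, Finset.card_range, nsmul_eq_mul, mul_one, smul_eq_mul]
    exact ENNReal.inv_mul_cancel (by positivity) (by simp)
  let A : ℕ → ProbabilityMeasure X := fun n => ⟨_, hprob n⟩
  have hA : ∀ (n : ℕ) (φ : C(X, ℝ)), ∫ x, φ x ∂(A n : Measure X)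
      = (∑ k ∈ Finset.range (n + 1), ∫ x, φ x ∂(ρ k : Measure X)) / (n + 1 : ℕ) := by
    intro n φ
    change ∫ x, φ x ∂(((n + 1 : ℕ) : ENNReal)⁻¹ • ∑ k ∈ Finset.range (n + 1), (ρ k : Measure X)) = _
    rw [integral_smul_measure, integral_finsetSum_measure fun k _ => integrable_of_continuous _ φ]
    rw [ENNReal.toReal_inv, ENNReal.toReal_natCast, smul_eq_mul, div_eq_inv_mul]
  -- `A n` averages `n + 1` terms to avoid dividing by zero; the shift restores the average over
  -- `range n`, for `n ≥ 1`.
  let B : ℕ → ProbabilityMeasure X := fun n => A (n - 1)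
  obtain ⟨μ, -, hμ⟩ := isCompact_univ.ultrafilter_le_nhds
    ((hyperfilter ℕ).map B) (by simp)
  refine ⟨μ, fun φ => ?_⟩
  have h1 : Tendsto B (hyperfilter ℕ : Filter ℕ) (𝓝 μ) := hμ
  refine (tendsto_probabilityMeasure_iff.1 h1 φ).congr' ?_
  have h2 : ∀ᶠ n : ℕ in (hyperfilter ℕ : Filter ℕ), 1 ≤ n :=
    Nat.hyperfilter_le_atTop (eventually_ge_atTop 1)
  filter_upwards [h2] with n hn
  obtain ⟨m, rfl⟩ : ∃ m, n = m + 1 := ⟨n - 1, by omega⟩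
  exact hA m φ

/-- Cesàro averages are asymptotically shift invariant. -/
theorem cesaro_shift {c : ℕ → ℝ} {C l l' : ℝ} (hc : ∀ n, |c n| ≤ C)
    (h : Tendsto (fun n : ℕ => (∑ k ∈ Finset.range n, c k) / n) (hyperfilter ℕ : Filter ℕ) (𝓝 l))
    (h' : Tendsto (fun n : ℕ => (∑ k ∈ Finset.range n, c (k + 1)) / n)
      (hyperfilter ℕ : Filter ℕ) (𝓝 l')) : l' = l := by
  -- The two averages differ by this telescoped boundary term.
  have h3 : Tendsto (fun n : ℕ => (c n - c 0) / n) (hyperfilter ℕ : Filter ℕ) (𝓝 0) := by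
    refine Tendsto.mono_left ?_ Nat.hyperfilter_le_atTop
    refine squeeze_zero_norm (a := fun n : ℕ => (2 * C) / n) (fun n => ?_)
      (tendsto_const_div_atTop_nhds_zero_nat _)
    rw [norm_div, Real.norm_eq_abs, RCLike.norm_natCast]
    gcongr
    have := abs_sub (c n) (c 0)
    linarith [hc n, hc 0]
  refine tendsto_nhds_unique h' ?_
  have h4 := h.add h3
  rw [add_zero] at h4
  refine h4.congr fun n => ?_
  rw [← add_div]
  congr 1
  have := Finset.sum_range_succ c n
  have := Finset.sum_range_succ' c n
  linarith

end Averaging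

/-! ### Joint continuity of the action and of the inverse action. -/

section Actions

instance instSecondCountableTopologySubsemigroup (G : Subsemigroup HomeoS1) :
    SecondCountableTopology G :=
  TopologicalSpace.Subtype.secondCountableTopology (G : Set HomeoS1)

instance instBorelSpaceSubsemigroup (G : Subsemigroup HomeoS1) : BorelSpace G :=
  Subtype.borelSpace (G : Set HomeoS1)

/-- By compactness the inverse images have a limit `y` along any ultrafilter; joint continuity of
evaluation forces `p.1 y = p.2`, which identifies `y`. -/
theorem continuous_symm_eval : Continuous (fun q : HomeoS1 × S1 => q.1.symm q.2) := by
  rw [continuous_iff_ultrafilter]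
  intro p U hU
  obtain ⟨y, -, hy⟩ := isCompact_univ.ultrafilter_le_nhds
    (U.map fun q : HomeoS1 × S1 => q.1.symm q.2) (by simp)
  have hy' : Tendsto (fun q : HomeoS1 × S1 => q.1.symm q.2) U (𝓝 y) := hy
  have hid : Tendsto id (U : Filter (HomeoS1 × S1)) (𝓝 p) := hU
  have h1 : Tendsto (fun q : HomeoS1 × S1 => (q.1, q.1.symm q.2)) U (𝓝 (p.1, y)) :=
    (continuous_fst.continuousAt.tendsto.comp hid).prodMk_nhds hy'
  have h2 := (continuous_eval.tendsto (p.1, y)).comp h1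
  have h3 : Tendsto (fun q : HomeoS1 × S1 => q.2) U (𝓝 p.2) :=
    continuous_snd.continuousAt.tendsto.comp hid
  have h4 : p.1 y = p.2 := tendsto_nhds_unique h2 (h3.congr fun q => by simp)
  rwa [← h4, Homeomorph.symm_apply_apply]

variable (G : Subsemigroup HomeoS1)

/-- The action of `G` on the circle. -/
def fwd : C(G × S1, S1) where
  toFun q := (q.1 : HomeoS1) q.2
  continuous_toFun := continuous_eval.comp
    ((continuous_subtype_val.comp continuous_fst).prodMk continuous_snd)

/-- The inverse action of `G` on the circle. -/
def bwd : C(G × S1, S1) where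
  toFun q := (q.1 : HomeoS1).symm q.2
  continuous_toFun := continuous_symm_eval.comp
    ((continuous_subtype_val.comp continuous_fst).prodMk continuous_snd)

/-- The diagonal action of `G` on pairs of points of the circle. -/
def fwdPair : C(G × (S1 × S1), S1 × S1) where
  toFun q := ((q.1 : HomeoS1) q.2.1, (q.1 : HomeoS1) q.2.2)
  continuous_toFun := by
    have h1 : Continuous fun q : G × (S1 × S1) => ((q.1 : HomeoS1), q.2.1) :=
      (continuous_subtype_val.comp continuous_fst).prodMk (continuous_fst.comp continuous_snd)
    have h2 : Continuous fun q : G × (S1 × S1) => ((q.1 : HomeoS1), q.2.2) :=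
      (continuous_subtype_val.comp continuous_fst).prodMk (continuous_snd.comp continuous_snd)
    exact (continuous_eval.comp h1).prodMk (continuous_eval.comp h2)

variable {G}

theorem fwd_apply (g : G) (x : S1) : fwd G (g, x) = (g : HomeoS1) x := rfl

/-- Pushing by inverses turns preimages into forward images of `A`: this is why the inverse walk
measures the growth of arcs under the walk. -/
theorem push_bwd_apply (ν : Measure G) [IsProbabilityMeasure ν] (μ : ProbabilityMeasure S1)
    {A : Set S1} (hA : MeasurableSet A) :
    (push ν (bwd G) μ : Measure S1) A = ∫⁻ g, (μ : Measure S1) ((g : HomeoS1) '' A) ∂ν := by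
  rw [push_apply ν _ μ hA]
  congr 1 with g
  congr 1
  ext x
  rw [Homeomorph.image_eq_preimage_symm]
  rfl

end Actions

/-! ### Arcs of the circle and their images under homeomorphisms. -/

section Arcs

/-- The closed arc of the circle covered by `[a, b]`. -/
def arc (a b : ℝ) : Set S1 := ((↑) : ℝ → S1) '' Set.Icc a b

theorem continuous_coe : Continuous ((↑) : ℝ → S1) := AddCircle.continuous_mk' 1

theorem isClosed_arc (a b : ℝ) : IsClosed (arc a b) :=
  (isCompact_Icc.image continuous_coe).isClosed

theorem isPreconnected_arc (a b : ℝ) : IsPreconnected (arc a b) :=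
  isPreconnected_Icc.image _ continuous_coe.continuousOn

theorem coe_add_intCast (a : ℝ) (n : ℤ) : ((a + n : ℝ) : S1) = a := by
  rw [AddCircle.coe_add]
  have : ((n : ℝ) : S1) = 0 := (AddCircle.coe_eq_zero_iff 1).2 ⟨n, by simp⟩
  rw [this, add_zero]

theorem arc_add_intCast (a b : ℝ) (n : ℤ) : arc (a + n) (b + n) = arc a b := by
  unfold arc
  rw [← Set.image_add_const_Icc, Set.image_image]
  simp only [coe_add_intCast]

theorem norm_coe_le_abs (t : ℝ) : ‖(t : S1)‖ ≤ |t| := by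
  rw [UnitAddCircle.norm_eq]
  simpa using round_le t 0

theorem norm_coe_eq_abs {t : ℝ} (ht : |t| ≤ 1 / 2) : ‖(t : S1)‖ = |t| := by
  have := (AddCircle.norm_coe_eq_abs_iff (p := (1 : ℝ)) (x := t) one_ne_zero)
  rw [abs_one] at this
  exact this.2 ht

theorem closedBall_eq_arc (x δ : ℝ) : Metric.closedBall (x : S1) δ = arc (x - δ) (x + δ) := by
  ext y
  rw [Metric.mem_closedBall, dist_eq_norm]
  constructor
  · intro h
    obtain ⟨t, rfl⟩ := QuotientAddGroup.mk_surjective y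
    change ‖(t : S1) - (x : S1)‖ ≤ δ at h
    rw [← AddCircle.coe_sub, UnitAddCircle.norm_eq, abs_le] at h
    refine ⟨t + (-round (t - x) : ℤ), ?_, coe_add_intCast t _⟩
    push_cast
    exact ⟨by linarith, by linarith⟩
  · rintro ⟨t, ht, rfl⟩
    rw [← AddCircle.coe_sub]
    refine (norm_coe_le_abs _).trans (abs_le.2 ⟨?_, ?_⟩) <;> linarith [ht.1, ht.2]

theorem isPreconnected_closedBall (x : S1) (δ : ℝ) : IsPreconnected (Metric.closedBall x δ) := by
  obtain ⟨t, rfl⟩ := QuotientAddGroup.mk_surjective x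
  have := closedBall_eq_arc t δ
  exact this ▸ isPreconnected_arc _ _

theorem injOn_coe_of_lt {a b : ℝ} (hab : b < a + 1) :
    Set.InjOn ((↑) : ℝ → S1) (Set.Icc a b) := by
  intro s hs t ht hst
  exact (AddCircle.coe_eq_coe_iff_of_mem_Ico (p := (1 : ℝ)) (a := a)
    ⟨hs.1, hs.2.trans_lt hab⟩ ⟨ht.1, ht.2.trans_lt hab⟩).1 hst

theorem exists_lift (f : HomeoS1) :
    ∃ F : ℝ → ℝ, Continuous F ∧ ∀ t : ℝ, (F t : S1) = f t := by
  obtain ⟨e, he⟩ := QuotientAddGroup.mk_surjective (f ((0 : ℝ) : S1))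
  obtain ⟨F, ⟨-, hF⟩, -⟩ := (AddCircle.isCoveringMap_coe (1 : ℝ)).existsUnique_continuousMap_lifts
    (⟨fun t : ℝ => f (t : S1), f.continuous.comp continuous_coe⟩ : C(ℝ, S1)) 0 e he
  exact ⟨F, F.continuous, fun t => congrFun hF t⟩

/-- A lift of `f` to the line is injective on `[a, b]`, hence strictly monotone there, and maps it
onto an interval. The two alternatives for the endpoints are the orientation-preserving and the
orientation-reversing case. -/
theorem image_arc (f : HomeoS1) {a b : ℝ} (hab : a ≤ b) (hb : b < a + 1) :
    ∃ c d : ℝ, c ≤ d ∧ d < c + 1 ∧ f '' arc a b = arc c d ∧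
      (((c : S1) = f a ∧ (d : S1) = f b) ∨ ((c : S1) = f b ∧ (d : S1) = f a)) := by
  obtain ⟨F, hF, hFf⟩ := exists_lift f
  have hinj : Set.InjOn F (Set.Icc a b) := fun s hs t ht hst =>
    injOn_coe_of_lt hb hs ht (f.injective (by rw [← hFf, ← hFf, hst]))
  have himg : f '' arc a b = ((↑) : ℝ → S1) '' (F '' Set.Icc a b) := by
    unfold arc
    rw [Set.image_image, Set.image_image]
    simp only [hFf]
  -- An image of length at least `1` would contain `c` and `c + 1`, the same point of the circle
  -- with two distinct preimages.
  have hlt : ∀ c d : ℝ, F '' Set.Icc a b = Set.Icc c d → c ≤ d → d < c + 1 := by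
    intro c d hcd hle
    by_contra! hcon
    have h1 : c ∈ F '' Set.Icc a b := hcd ▸ ⟨le_rfl, hle⟩
    have h2 : c + 1 ∈ F '' Set.Icc a b := hcd ▸ ⟨by linarith, hcon⟩
    obtain ⟨s, hs, hsc⟩ := h1
    obtain ⟨t, ht, htc⟩ := h2
    have : s = t := injOn_coe_of_lt hb hs ht (f.injective (by
      rw [← hFf, ← hFf, hsc, htc]
      have := coe_add_intCast c 1
      rw [Int.cast_one] at this
      exact this.symm))
    subst this
    linarith
  rcases hF.continuousOn.strictMonoOn_of_injOn_Icc' hab hinj with h | h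
  · have hle := h.monotoneOn (Set.left_mem_Icc.2 hab) (Set.right_mem_Icc.2 hab) hab
    have hI : F '' Set.Icc a b = Set.Icc (F a) (F b) := by
      refine Set.Subset.antisymm ?_ (intermediate_value_Icc hab hF.continuousOn)
      rintro _ ⟨t, ht, rfl⟩
      exact ⟨h.monotoneOn (Set.left_mem_Icc.2 hab) ht ht.1,
        h.monotoneOn ht (Set.right_mem_Icc.2 hab) ht.2⟩
    exact ⟨F a, F b, hle, hlt _ _ hI hle, by rw [himg, hI]; rfl, Or.inl ⟨hFf a, hFf b⟩⟩
  · have hle := h.antitoneOn (Set.left_mem_Icc.2 hab) (Set.right_mem_Icc.2 hab) hab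
    have hI : F '' Set.Icc a b = Set.Icc (F b) (F a) := by
      refine Set.Subset.antisymm ?_ (intermediate_value_Icc' hab hF.continuousOn)
      rintro _ ⟨t, ht, rfl⟩
      exact ⟨h.antitoneOn ht (Set.right_mem_Icc.2 hab) ht.2,
        h.antitoneOn (Set.left_mem_Icc.2 hab) ht ht.1⟩
    exact ⟨F b, F a, hle, hlt _ _ hI hle, by rw [himg, hI]; rfl, Or.inr ⟨hFf b, hFf a⟩⟩

/-- The distance to `x` is 1-Lipschitz and, by connectedness, takes every value of `[0, dist x y]`
on `A`; Lipschitz maps do not increase one-dimensional Hausdorff measure. -/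
theorem ofReal_dist_le_volume {A : Set S1} (hA : IsPreconnected A) (hm : MeasurableSet A)
    {x y : S1} (hx : x ∈ A) (hy : y ∈ A) : ENNReal.ofReal (dist x y) ≤ volume A := by
  set C : Set ℝ := ((↑) : ℝ → S1) ⁻¹' A ∩ Set.Ioc 0 (0 + 1) with hC
  have hvol : volume A = volume C := by
    rw [← (AddCircle.measurePreserving_mk 1 0).map_eq,
      Measure.map_apply AddCircle.measurable_mk' hm,
      Measure.restrict_apply (AddCircle.measurable_mk' hm)]
  have hlip : LipschitzWith 1 (fun t : ℝ => dist x (t : S1)) := by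
    refine LipschitzWith.of_dist_le_mul fun s t => ?_
    rw [NNReal.coe_one, one_mul]
    refine (dist_dist_dist_le_right x (s : S1) (t : S1)).trans ?_
    rw [dist_eq_norm, ← AddCircle.coe_sub]
    exact norm_coe_le_abs _
  have hsub : Set.Icc 0 (dist x y) ⊆ (fun t : ℝ => dist x (t : S1)) '' C := by
    have h1 := hA.intermediate_value hx hy (f := fun z => dist x z) (by fun_prop)
    rw [dist_self] at h1
    refine h1.trans ?_
    rintro _ ⟨z, hz, rfl⟩
    have h2 : z ∈ ((↑) : ℝ → S1) '' Set.Ioc 0 (0 + 1) := by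
      have := AddCircle.coe_image_Ioc_eq (1 : ℝ) 0
      rw [this]; trivial
    obtain ⟨t, ht, rfl⟩ := h2
    exact ⟨t, ⟨hz, ht⟩, rfl⟩
  have h3 := hlip.hausdorffMeasure_image_le zero_le_one C
  rw [hausdorffMeasure_real, ENNReal.coe_one, ENNReal.one_rpow, one_mul] at h3
  calc ENNReal.ofReal (dist x y) = volume (Set.Icc 0 (dist x y)) := by simp
    _ ≤ _ := measure_mono hsub
    _ ≤ _ := h3
    _ = _ := hvol.symm

end Arcs

/-! ### From almost sure invariance to invariance under the semigroup. -/

section Invariance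

variable {G : Subsemigroup HomeoS1} (ν : Measure G) [IsProbabilityMeasure ν]

theorem continuous_integral_comp (μ : ProbabilityMeasure S1) (φ : C(S1, ℝ)) :
    Continuous fun g : G => ∫ x, φ ((g : HomeoS1) x) ∂(μ : Measure S1) := by
  refine continuous_of_dominated (bound := fun _ => ‖φ‖)
    (fun g => (φ.continuous.comp (g : HomeoS1).continuous).aestronglyMeasurable)
    (fun g => ae_of_all _ fun _ => φ.norm_coe_le_norm _) (integrable_const _)
    (ae_of_all _ fun x => ?_)
  exact φ.continuous.comp ((fwd G).continuous.comp (by fun_prop : Continuous fun g : G => (g, x)))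

/-- A measure that almost every element preserves is preserved by the whole semigroup. -/
theorem preserves_of_ae {ν : Measure G} [IsProbabilityMeasure ν] (hν : NonDegenerate ν)
    (μ : ProbabilityMeasure S1)
    (h : ∀ φ : C(S1, ℝ), ∀ᵐ g : G ∂ν,
      ∫ x, φ ((g : HomeoS1) x) ∂(μ : Measure S1) = ∫ x, φ x ∂(μ : Measure S1)) :
    Preserves G (μ : Measure S1) := by
  -- The stabiliser of `μ` is a closed subsemigroup containing the support, so it is everything by
  -- non-degeneracy.
  let I : Subsemigroup G :=
    { carrier := {g | ∀ φ : C(S1, ℝ),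
        ∫ x, φ ((g : HomeoS1) x) ∂(μ : Measure S1) = ∫ x, φ x ∂(μ : Measure S1)}
      mul_mem' := by
        intro g k hg hk φ
        exact (hk (φ.comp ⟨(g : HomeoS1), (g : HomeoS1).continuous⟩)).trans (hg φ) }
  have hclosed : IsClosed (I : Set G) := by
    have : (I : Set G) = ⋂ φ : C(S1, ℝ), {g : G |
        ∫ x, φ ((g : HomeoS1) x) ∂(μ : Measure S1) = ∫ x, φ x ∂(μ : Measure S1)} := by
      ext g
      exact ⟨fun h => Set.mem_iInter.2 h, fun h => Set.mem_iInter.1 h⟩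
    rw [this]
    exact isClosed_iInter fun φ => isClosed_eq (continuous_integral_comp μ φ) continuous_const
  have hsupp : ν.support ⊆ I := fun g hg φ =>
    Measure.support_subset_of_isClosed
      (isClosed_eq (continuous_integral_comp μ φ) continuous_const) (h φ) hg
  have hle : Subsemigroup.closure ν.support ≤ I := Subsemigroup.closure_le.2 hsupp
  have huniv : (I : Set G) = Set.univ :=
    hclosed.closure_eq ▸ (hν.mono hle).closure_eq
  intro g hg
  have hgI : (⟨g, hg⟩ : G) ∈ (I : Set G) := huniv ▸ Set.mem_univ _
  have : IsProbabilityMeasure ((μ : Measure S1).map g) :=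
    Measure.isProbabilityMeasure_map g.continuous.measurable.aemeasurable
  refine ext_of_forall_integral_eq_of_IsFiniteMeasure fun f => ?_
  rw [integral_map g.continuous.measurable.aemeasurable f.continuous.aestronglyMeasurable]
  exact hgI f.toContinuousMap

end Invariance

/-! ### The inverse walk started from Lebesgue measure spreads out. -/

section Backward

theorem volume_singleton (x : S1) : volume ({x} : Set S1) = 0 := by
  have := AddCircle.volume_closedBall 1 (x := x) 0
  simpa using this

variable {G : Subsemigroup HomeoS1} (ν : Measure G) [IsProbabilityMeasure ν]

/-- The laws of the images of Lebesgue measure under the inverse random walk. -/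
noncomputable def lam (n : ℕ) : ProbabilityMeasure S1 :=
  (push ν (bwd G))^[n] ⟨volume, ⟨by simp⟩⟩

theorem lam_zero : (lam ν 0 : Measure S1) = volume := rfl

theorem lam_succ (n : ℕ) : lam ν (n + 1) = push ν (bwd G) (lam ν n) :=
  Function.iterate_succ_apply' _ _ _

/-- The distance as a continuous function of two variables. -/
noncomputable def distMap : C(S1 × S1, ℝ) := ⟨fun z => dist z.1 z.2, continuous_dist⟩

/-- Unfolding the recursion, `lam ν n A` is the expected length of the image of `A` under `n` steps
of the walk. This image is connected and contains the images of `x` and `y`. -/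
theorem ofReal_iterate_distMap_le (n : ℕ) {A : Set S1} (hA : IsClosed A) (hc : IsPreconnected A)
    {x y : S1} (hx : x ∈ A) (hy : y ∈ A) :
    ENNReal.ofReal ((avg ν (fwdPair G))^[n] distMap (x, y)) ≤ (lam ν n : Measure S1) A := by
  induction n generalizing A x y with
  | zero => exact ofReal_dist_le_volume hc hA.measurableSet hx hy
  | succ n ih =>
    have hpos : 0 ≤ (avg ν (fwdPair G))^[n] distMap := by
      have h0 : (0 : C(S1 × S1, ℝ)) ≤ distMap := fun z => dist_nonneg
      have := iterate_avg_mono ν (fwdPair G) h0 n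
      rwa [show (0 : C(S1 × S1, ℝ)) = ContinuousMap.const _ 0 from rfl, iterate_avg_const] at this
    rw [Function.iterate_succ_apply', avg_apply, lam_succ, push_bwd_apply ν _ hA.measurableSet,
      ofReal_integral_eq_lintegral_ofReal (integrable_slice ν _ _ _)
        (ae_of_all _ fun g => hpos _)]
    refine lintegral_mono fun g => ?_
    exact ih ((g : HomeoS1).isClosedMap _ hA)
      (hc.image _ (g : HomeoS1).continuous.continuousOn) (Set.mem_image_of_mem _ hx)
      (Set.mem_image_of_mem _ hy)

theorem exists_closedBall_lt {η : ProbabilityMeasure S1} {x : S1} {m : ENNReal}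
    (h : (η : Measure S1) {x} < m) : ∃ r > 0,
      ∀ᶠ η' : ProbabilityMeasure S1 in 𝓝 η, (η' : Measure S1) (Metric.closedBall x r) < m := by
  obtain ⟨U, hU, hUo, hUm⟩ := Set.exists_isOpen_lt_of_lt _ _ h
  obtain ⟨r, hr, hrU⟩ := Metric.nhds_basis_closedBall.mem_iff.1
    (hUo.mem_nhds (Set.singleton_subset_iff.1 hU))
  refine ⟨r, hr, ?_⟩
  have h1 := ProbabilityMeasure.limsup_measure_closed_le_of_tendsto
    (μ := η) (μs := fun η' : ProbabilityMeasure S1 => η') (L := 𝓝 η) tendsto_id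
    (Metric.isClosed_closedBall (x := x) (ε := r))
  exact eventually_lt_of_limsup_lt (h1.trans_lt ((measure_mono hrU).trans_lt hUm))

/-- This guarantees that a maximal atom exists over a compact family of measures. -/
theorem upperSemicontinuous_atom :
    UpperSemicontinuous fun q : ProbabilityMeasure S1 × S1 => (q.1 : Measure S1) {q.2} := by
  intro q m hq
  obtain ⟨r, hr, hev⟩ := exists_closedBall_lt hq
  have h1 : ∀ᶠ q' : ProbabilityMeasure S1 × S1 in 𝓝 q,
      (q'.1 : Measure S1) (Metric.closedBall q.2 r) < m :=
    (continuous_fst.tendsto q).eventually hev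
  have h2 : ∀ᶠ q' : ProbabilityMeasure S1 × S1 in 𝓝 q, q'.2 ∈ Metric.closedBall q.2 r :=
    (continuous_snd.tendsto q).eventually (Metric.closedBall_mem_nhds _ hr)
  filter_upwards [h1, h2] with q' h1 h2
  exact (measure_mono (Set.singleton_subset_iff.2 h2)).trans_lt h1

/-- The mass of `b` is the average of the masses of the points `g b`, none above `m`; an average
attaining the bound attains it almost surely. -/
theorem ae_atom_eq {η' : ProbabilityMeasure S1} {b : S1} {m : ENNReal}
    (hmax : ∀ c, (η' : Measure S1) {c} ≤ m)
    (hb : (push ν (bwd G) η' : Measure S1) {b} = m) :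
    ∀ᵐ g : G ∂ν, (η' : Measure S1) {(g : HomeoS1) b} = m := by
  rw [push_bwd_apply ν _ (measurableSet_singleton b)] at hb
  simp only [Set.image_singleton] at hb
  have hm : m ≠ ⊤ := by
    rw [← hb]
    refine ne_top_of_le_ne_top ENNReal.one_ne_top ((lintegral_mono fun g => prob_le_one).trans ?_)
    simp
  refine ae_eq_of_ae_le_of_lintegral_le (g := fun _ => m) (ae_of_all _ fun g => hmax _) ?_
    aemeasurable_const ?_
  · rw [hb]; exact hm
  · rw [hb]; simp

/-- The uniform probability measure on a nonempty finite set. -/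
noncomputable def uniformOn (s : Finset S1) (hs : s.Nonempty) : ProbabilityMeasure S1 :=
  ⟨(s.card : ENNReal)⁻¹ • ∑ b ∈ s, Measure.dirac b, ⟨by
    simp only [Measure.smul_apply, Measure.coe_finsetSum, Finset.sum_apply, measure_univ,
      Finset.sum_const, nsmul_eq_mul, mul_one, smul_eq_mul]
    exact ENNReal.inv_mul_cancel (by simpa using hs.ne_empty) (by simp)⟩⟩

theorem integral_uniformOn (s : Finset S1) (hs : s.Nonempty) (φ : C(S1, ℝ)) :
    ∫ x, φ x ∂(uniformOn s hs : Measure S1) = (∑ b ∈ s, φ b) / s.card := by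
  change ∫ x, φ x ∂((s.card : ENNReal)⁻¹ • ∑ b ∈ s, Measure.dirac b) = _
  rw [integral_smul_measure, integral_finsetSum_measure fun k _ => integrable_of_continuous _ φ]
  rw [ENNReal.toReal_inv, ENNReal.toReal_natCast, smul_eq_mul, div_eq_inv_mul]
  simp

theorem ncard_le_of_atoms {η : ProbabilityMeasure S1} {m : ENNReal} {N : ℕ} (hN : 1 < N * m)
    (A : Set S1) (hA : ∀ b ∈ A, (η : Measure S1) {b} = m) : A.Finite ∧ A.ncard ≤ N := by
  have hcard : ∀ s : Finset S1, (s : Set S1) ⊆ A → s.card < N := by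
    intro s hs
    by_contra! hcon
    have h1 : (η : Measure S1) s = s.card * m := by
      rw [← sum_measure_singleton, Finset.sum_congr rfl fun b hb => hA b (hs hb)]
      simp
    have h2 : (s.card : ENNReal) * m ≤ 1 := h1 ▸ prob_le_one
    have h3 : (N : ENNReal) * m ≤ s.card * m := by gcongr
    exact absurd hN (not_lt.2 (h3.trans h2))
  have hfin : A.Finite := by
    by_contra hinf
    obtain ⟨s, hs, hsN⟩ := Set.Infinite.exists_subset_card_eq hinf N
    exact absurd (hcard s hs) (by omega)
  refine ⟨hfin, ?_⟩
  rw [Set.ncard_eq_toFinset_card _ hfin]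
  exact (hcard hfin.toFinset (by simp)).le

/-- A sequence of finite sets permuted by almost every element yields an invariant measure. -/
theorem exists_preserves_of_finite_sets {ν : Measure G} [IsProbabilityMeasure ν]
    (hν : NonDegenerate ν) (A : ℕ → Set S1) (N : ℕ)
    (hfin : ∀ k, (A k).Finite ∧ (A k).ncard ≤ N) (hne : (A 0).Nonempty)
    (hA : ∀ k, ∀ b ∈ A k, ∀ᵐ g : G ∂ν, (g : HomeoS1) b ∈ A (k + 1)) :
    ∃ μ : ProbabilityMeasure S1, Preserves G (μ : Measure S1) := by
  have hae : ∀ᵐ g : G ∂ν, ∀ k, (g : HomeoS1) '' A k ⊆ A (k + 1) := by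
    rw [ae_all_iff]
    intro k
    have : ∀ᵐ g : G ∂ν, ∀ b ∈ A k, (g : HomeoS1) b ∈ A (k + 1) :=
      (ae_ball_iff (hfin k).1.countable).2 (hA k)
    filter_upwards [this] with g hg
    rintro _ ⟨b, hb, rfl⟩
    exact hg b hb
  have hstep : ∀ k, (A k).ncard ≤ (A (k + 1)).ncard := by
    intro k
    obtain ⟨g, hg⟩ := hae.exists
    rw [← Set.ncard_image_of_injective _ (g : HomeoS1).injective]
    exact Set.ncard_le_ncard (hg k) (hfin _).1
  have hmono : Monotone fun k => (A k).ncard := monotone_nat_of_le_succ hstep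
  -- The cardinalities increase and are bounded by `N`. Once they are stable, almost every `g` maps
  -- `A k` bijectively onto `A (k + 1)`, so the uniform measures are carried to each other and their
  -- Cesàro limit is invariant.
  obtain ⟨k₀, hk₀⟩ : ∃ k₀, ∀ k, (A k).ncard ≤ (A k₀).ncard := by
    have hb : BddAbove (Set.range fun k => (A k).ncard) :=
      ⟨N, by rintro _ ⟨k, rfl⟩; exact (hfin k).2⟩
    obtain ⟨k₀, hk₀⟩ := Nat.sSup_mem (Set.range_nonempty _) hb
    exact ⟨k₀, fun k => (le_csSup hb ⟨k, rfl⟩).trans hk₀.ge⟩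
  have hcard : ∀ k, (A (k₀ + k)).ncard = (A k₀).ncard := fun k =>
    le_antisymm (hk₀ _) (hmono (Nat.le_add_right _ _))
  have hnek : ∀ k, (A k).Nonempty := by
    intro k
    rw [← Set.ncard_pos (hfin k).1]
    exact ((Set.ncard_pos (hfin 0).1).2 hne).trans_le (hmono (Nat.zero_le k))
  let s : ℕ → Finset S1 := fun k => (hfin (k₀ + k)).1.toFinset
  have hs : ∀ k, (s k).Nonempty := fun k => by simpa [s] using hnek (k₀ + k)
  have hsc : ∀ k, (s k).card = (A k₀).ncard := fun k => by
    rw [← hcard k, Set.ncard_eq_toFinset_card _ (hfin (k₀ + k)).1]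
  obtain ⟨u, hu⟩ := exists_cesaro_limit fun k => uniformOn (s k) (hs k)
  refine ⟨u, preserves_of_ae hν u fun φ => ?_⟩
  filter_upwards [hae] with g hg
  have hgs : ∀ k, (s k).image (g : HomeoS1) = s (k + 1) := by
    intro k
    apply Finset.eq_of_subset_of_card_le
    · intro y hy
      obtain ⟨b, hb, rfl⟩ := Finset.mem_image.1 hy
      have hb' : b ∈ A (k₀ + k) := by simpa [s] using hb
      have := hg (k₀ + k) ⟨b, hb', rfl⟩
      simpa [s, add_assoc] using this
    · rw [Finset.card_image_of_injective _ (g : HomeoS1).injective, hsc, hsc]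
  let φg : C(S1, ℝ) := φ.comp ⟨(g : HomeoS1), (g : HomeoS1).continuous⟩
  have h1 := hu φ
  have h2 := hu φg
  refine cesaro_shift (fun n => integral_mem_bounds (uniformOn (s n) (hs n)) φ) h1 ?_
  refine h2.congr fun n => ?_
  congr 1
  refine Finset.sum_congr rfl fun k _ => ?_
  rw [integral_uniformOn, integral_uniformOn, hsc, hsc, ← hgs k,
    Finset.sum_image fun x _ y _ h => (g : HomeoS1).injective h]
  rfl

/-- Take an atom of maximal mass `m` over the compact closure `L`. Lebesgue measure has no atoms, so
a measure carrying such an atom is the push of another element of `L`, which again carries an atom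
of mass `m`. Going backwards forever gives finite sets, the atoms of mass `m`, mapped one into the
next by almost every `g`. -/
theorem no_atom_of_mem_closure {ν : Measure G} [IsProbabilityMeasure ν] (hν : NonDegenerate ν)
    (hinv : ¬ ∃ μ : ProbabilityMeasure S1, Preserves G (μ : Measure S1))
    {η : ProbabilityMeasure S1} (hη : η ∈ closure (Set.range (lam ν))) (x : S1) :
    (η : Measure S1) {x} = 0 := by
  set L := closure (Set.range (lam ν)) with hL
  have hpred : ∀ η ∈ L, η = lam ν 0 ∨ ∃ η' ∈ L, push ν (bwd G) η' = η := by
    have hclosed : IsClosed ({lam ν 0} ∪ push ν (bwd G) '' L) :=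
      isClosed_singleton.union
        ((isClosed_closure.isCompact).image (continuous_push ν _)).isClosed
    have hsub : L ⊆ {lam ν 0} ∪ push ν (bwd G) '' L := by
      refine closure_minimal ?_ hclosed
      rintro _ ⟨n, rfl⟩
      rcases n with _ | n
      · exact Or.inl rfl
      · exact Or.inr ⟨lam ν n, subset_closure ⟨n, rfl⟩, (lam_succ ν n).symm⟩
    intro η hη
    exact (hsub hη).imp id id
  by_contra hpos
  obtain ⟨⟨η₀, a₀⟩, ⟨hη₀, -⟩, hmax⟩ := UpperSemicontinuousOn.exists_isMaxOn
    (s := L ×ˢ (Set.univ : Set S1)) ⟨(η, x), hη, trivial⟩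
    ((isClosed_closure.isCompact).prod isCompact_univ)
    (upperSemicontinuous_atom.upperSemicontinuousOn _)
  set m := (η₀ : Measure S1) {a₀} with hm
  have hle : ∀ η ∈ L, ∀ c, (η : Measure S1) {c} ≤ m := fun η hη c =>
    hmax (a := (η, c)) ⟨hη, trivial⟩
  have hm0 : m ≠ 0 := fun h => hpos (le_antisymm (h ▸ hle η hη x) bot_le)
  have hnext : ∀ η : {η : ProbabilityMeasure S1 // η ∈ L ∧ ∃ b, (η : Measure S1) {b} = m},
      ∃ η' : {η : ProbabilityMeasure S1 // η ∈ L ∧ ∃ b, (η : Measure S1) {b} = m},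
        push ν (bwd G) η'.1 = η.1 := by
    rintro ⟨η, hηL, b, hb⟩
    rcases hpred η hηL with rfl | ⟨η', hη'L, hη'⟩
    · rw [lam_zero, volume_singleton] at hb
      exact absurd hb.symm hm0
    · have hae := ae_atom_eq ν (hle η' hη'L) (hη' ▸ hb)
      obtain ⟨g, hg⟩ := hae.exists
      exact ⟨⟨η', hη'L, _, hg⟩, hη'⟩
  choose pred hpred' using hnext
  let e : ℕ → {η : ProbabilityMeasure S1 // η ∈ L ∧ ∃ b, (η : Measure S1) {b} = m} :=
    fun k => pred^[k] ⟨η₀, hη₀, a₀, rfl⟩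
  have he : ∀ k, push ν (bwd G) (e (k + 1)).1 = (e k).1 := fun k => by
    have : e (k + 1) = pred (e k) := Function.iterate_succ_apply' _ _ _
    rw [this, hpred']
  -- A probability measure has fewer than `N` atoms of mass `m`: the cardinality bound is uniform
  -- along the chain.
  obtain ⟨N, hN⟩ : ∃ N : ℕ, 1 < N * m := by
    obtain ⟨N, -, hN⟩ := ENNReal.exists_nat_pos_mul_gt hm0 ENNReal.one_ne_top
    exact ⟨N, hN⟩
  refine hinv (exists_preserves_of_finite_sets hν
    (fun k => {b | ((e k).1 : Measure S1) {b} = m}) N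
    (fun k => ncard_le_of_atoms hN _ fun b hb => hb) ⟨a₀, rfl⟩ fun k b hb => ?_)
  exact ae_atom_eq ν (hle _ (e (k + 1)).2.1) (by rw [he k]; exact hb)

/-- The measures `lam ν n` give uniformly small mass to small balls. -/
theorem exists_lam_closedBall_le {ν : Measure G} [IsProbabilityMeasure ν] (hν : NonDegenerate ν)
    (hinv : ¬ ∃ μ : ProbabilityMeasure S1, Preserves G (μ : Measure S1))
    {ε : ENNReal} (hε : ε ≠ 0) : ∃ δ > 0, ∀ n x,
      (lam ν n : Measure S1) (Metric.closedBall x δ) ≤ ε := by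
  by_contra! hcon
  -- Radii shrinking to zero: a limit of the measures would charge the limit `y` of the centres.
  choose n x hnx using fun k : ℕ => hcon (1 / ((k : ℝ) + 1)) (by positivity)
  obtain ⟨η, -, hη⟩ := isCompact_univ.ultrafilter_le_nhds
    ((hyperfilter ℕ).map fun k => lam ν (n k)) (by simp)
  obtain ⟨y, -, hy⟩ := isCompact_univ.ultrafilter_le_nhds ((hyperfilter ℕ).map x) (by simp)
  have hη' : Tendsto (fun k => lam ν (n k)) (hyperfilter ℕ : Filter ℕ) (𝓝 η) := hη
  have hy' : Tendsto x (hyperfilter ℕ : Filter ℕ) (𝓝 y) := hy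
  have hηL : η ∈ closure (Set.range (lam ν)) :=
    mem_closure_of_tendsto hη' (Eventually.of_forall fun k => ⟨n k, rfl⟩)
  have h0 : (η : Measure S1) {y} < ε := by
    rw [no_atom_of_mem_closure hν hinv hηL]
    exact pos_iff_ne_zero.2 hε
  obtain ⟨r, hr, hev⟩ := exists_closedBall_lt h0
  have h1 : ∀ᶠ k in (hyperfilter ℕ : Filter ℕ), dist (x k) y < r / 2 :=
    hy'.eventually (Metric.ball_mem_nhds y (half_pos hr))
  have h2 : ∀ᶠ k : ℕ in (hyperfilter ℕ : Filter ℕ), 1 / ((k : ℝ) + 1) < r / 2 :=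
    Nat.hyperfilter_le_atTop
      ((tendsto_one_div_add_atTop_nhds_zero_nat (𝕜 := ℝ)).eventually_lt_const (half_pos hr))
  obtain ⟨k, hk1, hk2, hk3⟩ := (h1.and (h2.and (hη'.eventually hev))).exists
  refine absurd (hnx k) (not_lt.2 ((measure_mono ?_).trans hk3.le))
  exact Metric.closedBall_subset_closedBall' (by linarith)

end Backward

/-! ### Equicontinuity of the iterates of the averaging operator. -/

section Equicontinuity

variable {G : Subsemigroup HomeoS1} {ν : Measure G} [IsProbabilityMeasure ν]

theorem exists_iterate_distMap_le (hν : NonDegenerate ν)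
    (hinv : ¬ ∃ μ : ProbabilityMeasure S1, Preserves G (μ : Measure S1)) {ε : ℝ} (hε : 0 < ε) :
    ∃ δ > 0, ∀ n x y, dist x y ≤ δ → (avg ν (fwdPair G))^[n] distMap (x, y) ≤ ε := by
  obtain ⟨δ, hδ, h⟩ := exists_lam_closedBall_le hν hinv (ε := ENNReal.ofReal ε) (by simpa using hε)
  refine ⟨δ, hδ, fun n x y hxy => ?_⟩
  rw [← ENNReal.ofReal_le_ofReal_iff hε.le]
  exact (ofReal_iterate_distMap_le ν n Metric.isClosed_closedBall (isPreconnected_closedBall x δ)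
    (Metric.mem_closedBall_self hδ.le) (by rwa [Metric.mem_closedBall, dist_comm])).trans (h n x)

/-- The oscillation of a function, as a function of two variables. -/
noncomputable def oscMap (φ : C(S1, ℝ)) : C(S1 × S1, ℝ) := ⟨fun z => |φ z.1 - φ z.2|, by fun_prop⟩

/-- Both walks are driven by the same random maps, so differences of averages are averages of
differences over the pair walk. -/
theorem abs_iterate_sub_le (φ : C(S1, ℝ)) (n : ℕ) (x y : S1) :
    |(avg ν (fwd G))^[n] φ x - (avg ν (fwd G))^[n] φ y| ≤
      (avg ν (fwdPair G))^[n] (oscMap φ) (x, y) := by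
  induction n generalizing x y with
  | zero => exact le_rfl
  | succ n ih =>
    rw [Function.iterate_succ_apply', Function.iterate_succ_apply', avg_apply, avg_apply, avg_apply,
      ← integral_sub (integrable_slice ν (fwd G) ((avg ν (fwd G))^[n] φ) x)
        (integrable_slice ν (fwd G) ((avg ν (fwd G))^[n] φ) y)]
    refine abs_integral_le_integral_abs.trans ?_
    exact integral_mono
      ((integrable_slice ν (fwd G) ((avg ν (fwd G))^[n] φ) x).sub
        (integrable_slice ν (fwd G) ((avg ν (fwd G))^[n] φ) y)).abs
      (integrable_slice ν (fwdPair G) ((avg ν (fwdPair G))^[n] (oscMap φ)) (x, y))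
      fun g => ih _ _

/-- The additive `ε` handles close pairs by uniform continuity, the multiple of the distance handles
far pairs. Being linear in `distMap`, the bound survives the iteration of the averaging operator. -/
theorem oscMap_le (φ : C(S1, ℝ)) {ε : ℝ} (hε : 0 < ε) : ∃ c : ℝ, 0 ≤ c ∧
    oscMap φ ≤ ContinuousMap.const _ ε + c • distMap := by
  obtain ⟨δ, hδ, h⟩ := Metric.uniformContinuous_iff.1
    (CompactSpace.uniformContinuous_of_continuous φ.continuous) ε hε
  refine ⟨2 * ‖φ‖ / δ, by positivity, fun z => ?_⟩
  change |φ z.1 - φ z.2| ≤ ε + 2 * ‖φ‖ / δ * dist z.1 z.2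
  rcases lt_or_ge (dist z.1 z.2) δ with hz | hz
  · have h1 := (h hz).le
    rw [Real.dist_eq] at h1
    have : 0 ≤ 2 * ‖φ‖ / δ * dist z.1 z.2 := by positivity
    linarith
  · have h1 : |φ z.1 - φ z.2| ≤ 2 * ‖φ‖ := by
      have := abs_sub (φ z.1) (φ z.2)
      have h2 := φ.norm_coe_le_norm z.1
      have h3 := φ.norm_coe_le_norm z.2
      rw [Real.norm_eq_abs] at h2 h3
      linarith
    have h2 : 2 * ‖φ‖ ≤ 2 * ‖φ‖ / δ * dist z.1 z.2 := by
      rw [div_mul_eq_mul_div, le_div_iff₀ hδ]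
      gcongr
    linarith

/-- The iterates of the averaging operator are uniformly equicontinuous. -/
theorem exists_equicontinuity (hν : NonDegenerate ν)
    (hinv : ¬ ∃ μ : ProbabilityMeasure S1, Preserves G (μ : Measure S1)) (φ : C(S1, ℝ))
    {ε : ℝ} (hε : 0 < ε) : ∃ δ > 0, ∀ n x y, dist x y ≤ δ →
      |(avg ν (fwd G))^[n] φ x - (avg ν (fwd G))^[n] φ y| ≤ ε := by
  obtain ⟨c, hc, hφ⟩ := oscMap_le φ (half_pos hε)
  -- The `+ 1` guards against `c = 0`; the distance term then contributes at most `ε / 2`.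
  obtain ⟨δ, hδ, h⟩ := exists_iterate_distMap_le hν hinv (ε := ε / (2 * (c + 1))) (by positivity)
  refine ⟨δ, hδ, fun n x y hxy => (abs_iterate_sub_le φ n x y).trans ?_⟩
  refine (iterate_avg_mono ν _ hφ n (x, y)).trans ?_
  rw [iterate_avg_add, iterate_avg_const, iterate_avg_smul]
  change ε / 2 + c * _ ≤ ε
  have h1 := h n x y hxy
  have h2 : c * (ε / (2 * (c + 1))) ≤ ε / 2 := by
    rw [mul_div_assoc', div_le_div_iff₀ (by positivity) (by positivity)]
    nlinarith
  nlinarith [mul_le_mul_of_nonneg_left h1 hc]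

end Equicontinuity

/-! ### An atomless measure stationary for the inverse walk. -/

section BackwardStationary

variable {G : Subsemigroup HomeoS1} (ν : Measure G) [IsProbabilityMeasure ν]

theorem integral_le_measureReal {μ : ProbabilityMeasure S1} {φ : C(S1, ℝ)} {U : Set S1}
    (hU : MeasurableSet U) (h0 : ∀ x ∉ U, φ x = 0) (h1 : ∀ x, φ x ≤ 1) :
    ∫ x, φ x ∂(μ : Measure S1) ≤ (μ : Measure S1).real U := by
  rw [← integral_indicator_one hU]
  refine integral_mono (integrable_of_continuous _ φ)
    ((integrable_const (1 : ℝ)).indicator hU) fun x => ?_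
  by_cases hx : x ∈ U
  · simpa [hx] using h1 x
  · simp [hx, h0 x hx]

theorem measureReal_le_integral {μ : ProbabilityMeasure S1} {φ : C(S1, ℝ)} {C : Set S1}
    (hC : MeasurableSet C) (h0 : ∀ x, 0 ≤ φ x) (h1 : ∀ x ∈ C, φ x = 1) :
    (μ : Measure S1).real C ≤ ∫ x, φ x ∂(μ : Measure S1) := by
  rw [← integral_indicator_one hC]
  refine integral_mono ((integrable_const (1 : ℝ)).indicator hC)
    (integrable_of_continuous _ φ) fun x => ?_
  by_cases hx : x ∈ C
  · simp [hx, h1 x hx]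
  · simpa [hx] using h0 x

theorem exists_urysohn {C U : Set S1} (hC : IsClosed C) (hU : IsOpen U) (hCU : C ⊆ U) :
    ∃ φ : C(S1, ℝ), (∀ x ∉ U, φ x = 0) ∧ (∀ x ∈ C, φ x = 1) ∧ (∀ x, 0 ≤ φ x) ∧
      ∀ x, φ x ≤ 1 := by
  obtain ⟨φ, h0, h1, h⟩ := exists_continuous_zero_one_of_isClosed hU.isClosed_compl hC
    (Set.disjoint_compl_left_iff_subset.2 hCU)
  exact ⟨φ, fun x hx => h0 hx, fun x hx => h1 hx, fun x => (h x).1, fun x => (h x).2⟩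

theorem cesaro_le {c : ℕ → ℝ} {C l : ℝ} (hc : ∀ n, c n ≤ C)
    (h : Tendsto (fun n : ℕ => (∑ k ∈ Finset.range n, c k) / n)
      (hyperfilter ℕ : Filter ℕ) (𝓝 l)) : l ≤ C := by
  refine le_of_tendsto h ?_
  filter_upwards [Nat.hyperfilter_le_atTop (eventually_ge_atTop 1)] with n hn
  rw [div_le_iff₀ (by positivity)]
  refine (Finset.sum_le_sum fun k _ => hc k).trans ?_
  simp [mul_comm]

theorem le_cesaro {c : ℕ → ℝ} {C l : ℝ} (hc : ∀ n, C ≤ c n)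
    (h : Tendsto (fun n : ℕ => (∑ k ∈ Finset.range n, c k) / n)
      (hyperfilter ℕ : Filter ℕ) (𝓝 l)) : C ≤ l := by
  refine ge_of_tendsto h ?_
  filter_upwards [Nat.hyperfilter_le_atTop (eventually_ge_atTop 1)] with n hn
  rw [le_div_iff₀ (by positivity)]
  refine le_trans ?_ (Finset.sum_le_sum fun k _ => hc k)
  simp [mul_comm]

/-- A backward stationary measure without atoms that charges every closed set whose measure under
the backward random walk stays away from zero. -/
structure IsBackwardLimit (m : ProbabilityMeasure S1) : Prop where
  push_eq : push ν (bwd G) m = m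
  closedBall_le : ∀ ε > 0, ∃ δ > 0, ∀ x, (m : Measure S1).real (Metric.closedBall x δ) ≤ ε
  le_of_le_lam : ∀ (C : Set S1) (c : ℝ), IsClosed C →
    (∀ n, c ≤ (lam ν n : Measure S1).real C) → c ≤ (m : Measure S1).real C

theorem exists_isBackwardLimit {ν : Measure G} [IsProbabilityMeasure ν] (hν : NonDegenerate ν)
    (hinv : ¬ ∃ μ : ProbabilityMeasure S1, Preserves G (μ : Measure S1)) :
    ∃ m, IsBackwardLimit ν m := by
  obtain ⟨m, hm⟩ := exists_cesaro_limit (lam ν)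
  refine ⟨m, ?_, ?_, ?_⟩
  · refine probabilityMeasure_ext fun φ => ?_
    rw [integral_push]
    have h1 := hm (avg ν (bwd G) φ)
    refine cesaro_shift (fun n => integral_mem_bounds (lam ν n) φ) (hm φ) ?_
    refine h1.congr fun n => ?_
    simp only [lam_succ, integral_push]
  · intro ε hε
    obtain ⟨δ, hδ, h⟩ := exists_lam_closedBall_le hν hinv (ε := ENNReal.ofReal ε) (by simpa using hε)
    -- A continuous bump equal to `1` on the ball of radius `δ / 2` and supported in the ball of
    -- radius `δ` transfers the bound to the limit.
    refine ⟨δ / 2, by positivity, fun x => ?_⟩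
    obtain ⟨φ, h0, h1, hpos, hle⟩ := exists_urysohn (C := Metric.closedBall x (δ / 2))
      (U := Metric.ball x δ) Metric.isClosed_closedBall Metric.isOpen_ball
      (Metric.closedBall_subset_ball (by linarith))
    refine (measureReal_le_integral Metric.isClosed_closedBall.measurableSet hpos h1).trans ?_
    refine cesaro_le (fun n => ?_) (hm φ)
    refine (integral_le_measureReal Metric.isOpen_ball.measurableSet h0 hle).trans ?_
    exact ENNReal.toReal_le_of_le_ofReal hε.le
      ((measure_mono Metric.ball_subset_closedBall).trans (h n x))
  · intro C c hC hc
    by_contra! hlt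
    have hlt' : (m : Measure S1) C < ENNReal.ofReal c :=
      (ENNReal.lt_ofReal_iff_toReal_lt (measure_ne_top _ _)).2 hlt
    obtain ⟨U, hCU, hU, hUc⟩ := Set.exists_isOpen_lt_of_lt _ _ hlt'
    obtain ⟨φ, h0, h1, hpos, hle⟩ := exists_urysohn hC hU hCU
    have h2 : c ≤ (m : Measure S1).real U :=
      (le_cesaro (fun n => (hc n).trans (measureReal_le_integral hC.measurableSet hpos h1))
        (hm φ)).trans (integral_le_measureReal hU.measurableSet h0 hle)
    exact absurd ((ENNReal.lt_ofReal_iff_toReal_lt (measure_ne_top _ _)).1 hUc) (not_lt.2 h2)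

end BackwardStationary

/-! ### Collapsing the circle along an atomless measure. -/

section Collapse

/-- The representative in `[0, 1)` of a point of the circle. -/
noncomputable def rep (x : S1) : ℝ := (AddCircle.equivIco 1 0 x : ℝ)

theorem rep_coe {t : ℝ} (h0 : 0 ≤ t) (h1 : t < 1) : rep (t : S1) = t := by
  unfold rep
  rw [AddCircle.equivIco_coe_eq (p := (1 : ℝ)) (a := 0) (x := t) ⟨h0, by simpa using h1⟩]

theorem rep_mem (x : S1) : 0 ≤ rep x ∧ rep x < 1 := by
  have := (AddCircle.equivIco 1 0 x).2
  exact ⟨this.1, this.2.trans_eq (zero_add 1)⟩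

theorem coe_rep (x : S1) : (rep x : S1) = x := (AddCircle.equivIco 1 0).symm_apply_apply x

theorem exists_rep_le (x y : S1) : ∃ a b : ℝ, a ≤ b ∧ b < a + 1 ∧ (a : S1) = x ∧ (b : S1) = y := by
  have h : y ∈ ((↑) : ℝ → S1) '' Set.Ico (rep x) (rep x + 1) := by
    rw [AddCircle.coe_image_Ico_eq (1 : ℝ) (rep x)]; trivial
  obtain ⟨b, hb, rfl⟩ := h
  exact ⟨rep x, b, hb.1, hb.2, coe_rep x, rfl⟩

theorem exists_rep_dist (x y : S1) : ∃ a t : ℝ, (a : S1) = x ∧ ((a + t : ℝ) : S1) = y ∧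
    |t| = dist x y := by
  obtain ⟨s, hs⟩ := QuotientAddGroup.mk_surjective (y - x)
  change (s : S1) = y - x at hs
  refine ⟨rep x, s + (-round s : ℤ), coe_rep x, ?_, ?_⟩
  · rw [AddCircle.coe_add, coe_rep, coe_add_intCast, hs, add_sub_cancel]
  · rw [dist_comm, dist_eq_norm, ← hs, UnitAddCircle.norm_eq]
    push_cast
    rw [sub_eq_add_neg]

theorem arc_subset_closedBall {a t δ : ℝ} (h0 : 0 ≤ t) (ht : t ≤ δ) :
    arc a (a + t) ⊆ Metric.closedBall (a : S1) δ ∧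
      arc a (a + t) ⊆ Metric.closedBall ((a + t : ℝ) : S1) δ := by
  rw [closedBall_eq_arc, closedBall_eq_arc]
  exact ⟨Set.image_mono (Set.Icc_subset_Icc (by linarith) (by linarith)),
    Set.image_mono (Set.Icc_subset_Icc (by linarith) (by linarith))⟩

theorem arc_self_add_one (a : ℝ) : arc a (a + 1) = Set.univ := by
  have := AddCircle.coe_image_Icc_eq (1 : ℝ) a
  exact this

theorem arc_self (a : ℝ) : arc a a = {(a : S1)} := by
  simp [arc]

/-- Normalised position on the circle, from the length of the arc: `t (1 - t)`. -/
theorem norm_coe_mul_one_sub {t : ℝ} (h0 : 0 ≤ t) (h1 : t ≤ 1) :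
    ‖(t : S1)‖ * (1 - ‖(t : S1)‖) = t * (1 - t) := by
  rcases le_total t (1 / 2) with h | h
  · rw [norm_coe_eq_abs (by rwa [abs_of_nonneg h0]), abs_of_nonneg h0]
  · have h2 : ((t - 1 : ℝ) : S1) = t := by
      have := coe_add_intCast t (-1)
      push_cast at this
      rwa [← sub_eq_add_neg] at this
    rw [← h2, norm_coe_eq_abs (abs_le.2 ⟨by linarith, by linarith⟩), abs_of_nonpos (by linarith)]
    ring

variable (m : Measure S1) [IsProbabilityMeasure m]

theorem measureReal_arc_add (hm : ∀ x, m {x} = 0) {a b c : ℝ} (hab : a ≤ b) (hbc : b ≤ c)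
    (hca : c ≤ a + 1) : m.real (arc a c) = m.real (arc a b) + m.real (arc b c) := by
  have hun : arc a c = arc a b ∪ arc b c := by
    unfold arc
    rw [← Set.image_union, Set.Icc_union_Icc_eq_Icc hab hbc]
  have hint : arc a b ∩ arc b c ⊆ {(a : S1), (b : S1)} := by
    rintro z ⟨⟨s, hs, rfl⟩, ⟨t, ht, hts⟩⟩
    have hcoe : ((a + 1 : ℝ) : S1) = a := by
      have := coe_add_intCast a 1
      rwa [Int.cast_one] at this
    rcases eq_or_lt_of_le (ht.2.trans hca) with h1 | h1
    · left
      rw [← hts, h1, hcoe]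
    rcases eq_or_lt_of_le (hs.2.trans (hbc.trans hca)) with h2 | h2
    · left
      rw [h2, hcoe]
    right
    have := (AddCircle.coe_eq_coe_iff_of_mem_Ico (p := (1 : ℝ)) (a := a)
      ⟨hab.trans ht.1, h1⟩ ⟨hs.1, h2⟩).1 hts
    rw [Set.mem_singleton_iff, le_antisymm hs.2 (this ▸ ht.1)]
  have hnull : m (arc a b ∩ arc b c) = 0 := by
    refine measure_mono_null hint ?_
    rw [Set.insert_eq]
    exact measure_union_null (hm _) (hm _)
  rw [hun, measureReal_def, measureReal_def, measureReal_def,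
    measure_union₀ (isClosed_arc b c).measurableSet.nullMeasurableSet hnull,
    ENNReal.toReal_add (measure_ne_top _ _) (measure_ne_top _ _)]

/-- The map collapsing the circle along a measure. -/
noncomputable def collapse (x : S1) : S1 := (m.real (arc 0 (rep x)) : ℝ)

/-- After collapsing, displacement along an arc is its mass modulo `1`. When the arc crosses the
base point `0`, the total mass `1` compensates for the restart of `rep`. -/
theorem collapse_sub (hm : ∀ x, m {x} = 0) {a b : ℝ} (hab : a ≤ b) (hb : b < a + 1) :
    collapse m b - collapse m a = (m.real (arc a b) : ℝ) := by
  wlog ha : 0 ≤ a ∧ a < 1 generalizing a b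
  · have := this (a := a + (-⌊a⌋ : ℤ)) (b := b + (-⌊a⌋ : ℤ)) (by linarith) (by linarith)
      ⟨by push_cast; linarith [Int.floor_le a], by push_cast; linarith [Int.lt_floor_add_one a]⟩
    rwa [coe_add_intCast, coe_add_intCast, arc_add_intCast] at this
  obtain ⟨ha0, ha1⟩ := ha
  have hcoll : ∀ t : ℝ, 0 ≤ t → t < 1 → collapse m t = (m.real (arc 0 t) : ℝ) := fun t h0 h1 => by
    rw [collapse, rep_coe h0 h1]
  rcases lt_or_ge b 1 with hb1 | hb1
  · rw [hcoll a ha0 ha1, hcoll b (ha0.trans hab) hb1,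
      measureReal_arc_add m hm ha0 hab (by linarith), AddCircle.coe_add, add_sub_cancel_left]
  · have h1 : collapse m b = (m.real (arc 0 (b - 1)) : ℝ) := by
      rw [← hcoll (b - 1) (by linarith) (by linarith)]
      have := coe_add_intCast b (-1)
      push_cast at this
      rw [← sub_eq_add_neg] at this
      rw [this]
    have h2 : m.real (arc 1 b) = m.real (arc 0 (b - 1)) := by
      have := arc_add_intCast 0 (b - 1) 1
      push_cast at this
      rw [zero_add, sub_add_cancel] at this
      rw [this]
    have h3 : m.real (arc 0 a) + m.real (arc a 1) = 1 := by
      rw [← measureReal_arc_add m hm ha0 ha1.le (by linarith)]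
      have := arc_self_add_one 0
      rw [zero_add] at this
      rw [this, probReal_univ]
    rw [h1, hcoll a ha0 ha1, measureReal_arc_add m hm ha1.le hb1 hb.le, h2, ← AddCircle.coe_sub]
    have h4 := coe_add_intCast (m.real (arc 0 (b - 1)) - m.real (arc 0 a)) 1
    rw [← h4]
    congr 1
    push_cast
    linarith

theorem dist_collapse_le (hm : ∀ x, m {x} = 0) {x y : S1} {δ : ℝ} (hxy : dist x y ≤ δ) :
    dist (collapse m x) (collapse m y) ≤ m.real (Metric.closedBall x δ) := by
  obtain ⟨a, t, rfl, rfl, ht⟩ := exists_rep_dist x y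
  have habs : |t| ≤ 1 / 2 := by
    rw [ht, dist_eq_norm]
    have := AddCircle.norm_le_half_period (x := (a : S1) - ((a + t : ℝ) : S1)) 1 one_ne_zero
    rwa [abs_one] at this
  have hnorm : ∀ A : Set S1, ‖((m.real A : ℝ) : S1)‖ ≤ m.real A := fun A =>
    (norm_coe_le_abs _).trans (abs_of_nonneg measureReal_nonneg).le
  rcases le_total 0 t with h0 | h0
  · rw [abs_of_nonneg h0] at ht habs
    rw [dist_comm, dist_eq_norm, collapse_sub m hm (by linarith) (by linarith)]
    exact (hnorm _).trans (measureReal_mono (arc_subset_closedBall h0 (ht ▸ hxy)).1)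
  · rw [abs_of_nonpos h0] at ht habs
    have h1 := collapse_sub m hm (a := a + t) (b := a) (by linarith) (by linarith)
    rw [dist_eq_norm, h1]
    have h2 := (arc_subset_closedBall (a := a + t) (t := -t) (by linarith) (ht ▸ hxy)).2
    rw [add_neg_cancel_right] at h2
    exact (hnorm _).trans (measureReal_mono h2)

theorem singleton_eq_zero_of_closedBall_le
    (h : ∀ ε > 0, ∃ δ > 0, ∀ x, m.real (Metric.closedBall x δ) ≤ ε) (x : S1) : m {x} = 0 := by
  have h1 : m.real {x} ≤ 0 := by
    refine le_of_forall_pos_le_add fun ε hε => ?_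
    obtain ⟨δ, hδ, hx⟩ := h ε hε
    rw [zero_add]
    exact (measureReal_mono (Set.singleton_subset_iff.2 (Metric.mem_closedBall_self hδ.le))).trans
      (hx x)
  have h2 := le_antisymm h1 measureReal_nonneg
  rwa [measureReal_def, ENNReal.toReal_eq_zero_iff, or_iff_left (measure_ne_top _ _)] at h2

theorem continuous_collapse
    (h : ∀ ε > 0, ∃ δ > 0, ∀ x, m.real (Metric.closedBall x δ) ≤ ε) : Continuous (collapse m) := by
  rw [Metric.continuous_iff]
  intro x ε hε
  obtain ⟨δ, hδ, hx⟩ := h (ε / 2) (by positivity)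
  refine ⟨δ, hδ, fun y hy => ?_⟩
  have h1 := (dist_collapse_le m (singleton_eq_zero_of_closedBall_le m h) hy.le).trans (hx y)
  linarith

/-- Two probability measures giving the same mass to all arcs starting at `0` agree. -/
theorem ext_of_arc {m' : Measure S1} [IsProbabilityMeasure m']
    (h : ∀ t, 0 ≤ t → t < 1 → m (arc 0 t) = m' (arc 0 t)) : m = m' := by
  have hmeas : Measurable rep :=
    measurable_subtype_coe.comp (AddCircle.measurableEquivIco 1 0).measurable
  have hpre : ∀ t, 0 ≤ t → t < 1 → rep ⁻¹' Set.Iic t = arc 0 t := by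
    intro t h0 h1
    ext x
    constructor
    · intro hx
      exact ⟨rep x, ⟨(rep_mem x).1, hx⟩, coe_rep x⟩
    · rintro ⟨s, hs, rfl⟩
      rw [Set.mem_preimage, rep_coe hs.1 (hs.2.trans_lt h1)]
      exact hs.2
  have h1 : m.map rep = m'.map rep := by
    have : IsProbabilityMeasure (m.map rep) := Measure.isProbabilityMeasure_map hmeas.aemeasurable
    refine Measure.ext_of_Iic _ _ fun t => ?_
    rw [Measure.map_apply hmeas measurableSet_Iic, Measure.map_apply hmeas measurableSet_Iic]
    rcases lt_or_ge t 0 with ht | ht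
    · have : rep ⁻¹' Set.Iic t = ∅ := by
        ext x
        simpa using ht.trans_le (rep_mem x).1
      rw [this, measure_empty, measure_empty]
    rcases lt_or_ge t 1 with ht1 | ht1
    · rw [hpre t ht ht1, h t ht ht1]
    · have : rep ⁻¹' Set.Iic t = Set.univ := by
        ext x
        simpa using (rep_mem x).2.le.trans ht1
      rw [this, measure_univ, measure_univ]
  have h2 : ∀ μ : Measure S1, (μ.map rep).map ((↑) : ℝ → S1) = μ := by
    intro μ
    rw [Measure.map_map AddCircle.measurable_mk' hmeas]
    have : ((↑) : ℝ → S1) ∘ rep = id := funext coe_rep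
    rw [this, Measure.map_id]
  rw [← h2 m, h1, h2 m']

/-- A homeomorphism that does not increase distances after collapsing preserves the measure. -/
theorem map_eq_of_dist_collapse_le
    (hb : ∀ ε > 0, ∃ δ > 0, ∀ x, m.real (Metric.closedBall x δ) ≤ ε) (f : HomeoS1)
    (hf : ∀ x y, dist (collapse m (f x)) (collapse m (f y)) ≤ dist (collapse m x) (collapse m y)) :
    m.map f = m := by
  have hm := singleton_eq_zero_of_closedBall_le m hb
  have hfm : Measurable f.symm := f.symm.continuous.measurable
  have : IsProbabilityMeasure (m.map f.symm) := Measure.isProbabilityMeasure_map hfm.aemeasurable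
  have happ : ∀ A : Set S1, MeasurableSet A → m.map f.symm A = m (f '' A) := fun A hA => by
    rw [Measure.map_apply hfm hA, Homeomorph.image_eq_preimage_symm]
  have hm' : ∀ x, m.map f.symm {x} = 0 := fun x => by
    rw [happ _ (measurableSet_singleton x), Set.image_singleton, hm]
  -- Mass at most `1/3`, hence below `1/2`, makes the collapsed distance of the endpoints equal to
  -- the mass of the arc itself rather than of its complement.
  obtain ⟨δ₁, hδ₁, h1⟩ := hb (1 / 3) (by norm_num)
  obtain ⟨δ₂, hδ₂, h2⟩ := Metric.uniformContinuous_iff.1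
    (CompactSpace.uniformContinuous_of_continuous f.continuous) δ₁ hδ₁
  obtain ⟨δ, hδ, hδ1, hδ2, hδ3⟩ : ∃ δ > 0, δ ≤ δ₁ ∧ δ < δ₂ ∧ δ < 1 :=
    ⟨min δ₁ (min (δ₂ / 2) (1 / 2)), by positivity, min_le_left _ _,
      ((min_le_right _ _).trans (min_le_left _ _)).trans_lt (by linarith),
      ((min_le_right _ _).trans (min_le_right _ _)).trans_lt (by norm_num)⟩
  have hdist : ∀ s : ℝ, 0 ≤ s → s ≤ 1 / 3 → ‖(s : S1)‖ = s := fun s h0 h1 => by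
    rw [norm_coe_eq_abs (by rw [abs_of_nonneg h0]; linarith), abs_of_nonneg h0]
  -- On short arcs the hypothesis on distances becomes an inequality between the masses of `f '' arc
  -- a b` and `arc a b`.
  have hshort : ∀ a b : ℝ, a ≤ b → b ≤ a + δ →
      (m.map f.symm).real (arc a b) ≤ m.real (arc a b) := by
    intro a b hab hba
    have hsub := (arc_subset_closedBall (a := a) (t := b - a) (δ := δ)
      (by linarith) (by linarith)).1
    rw [add_sub_cancel] at hsub
    have e1 : dist (collapse m a) (collapse m b) = m.real (arc a b) := by
      rw [dist_comm, dist_eq_norm, collapse_sub m hm hab (by linarith)]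
      exact hdist _ measureReal_nonneg ((measureReal_mono
        (hsub.trans (Metric.closedBall_subset_closedBall hδ1))).trans (h1 _))
    obtain ⟨c, d, hcd, hdc, himg, hends⟩ := image_arc f hab (by linarith : b < a + 1)
    have hsub2 : arc c d ⊆ Metric.closedBall (f a) δ₁ := by
      rw [← himg]
      rintro _ ⟨z, hz, rfl⟩
      exact (h2 ((Metric.mem_closedBall.1 (hsub hz)).trans_lt hδ2)).le
    have e2 : dist (collapse m c) (collapse m d) = m.real (arc c d) := by
      rw [dist_comm, dist_eq_norm, collapse_sub m hm hcd hdc]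
      exact hdist _ measureReal_nonneg ((measureReal_mono hsub2).trans (h1 _))
    have e3 : dist (collapse m (f a)) (collapse m (f b)) = m.real (arc c d) := by
      rcases hends with ⟨h3, h4⟩ | ⟨h3, h4⟩
      · rw [← h3, ← h4, e2]
      · rw [← h3, ← h4, dist_comm, e2]
    rw [measureReal_def, happ _ (isClosed_arc a b).measurableSet, himg, ← measureReal_def, ← e3,
      ← e1]
    exact hf _ _
  -- Cutting into short arcs makes `Φ` monotone; as both measures have total mass `1`, it vanishes
  -- at `0` and at `1`, hence throughout.
  set Φ : ℝ → ℝ := fun t => m.real (arc 0 t) - (m.map f.symm).real (arc 0 t) with hΦ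
  have hloc : ∀ n : ℕ, ∀ a b : ℝ, 0 ≤ a → a ≤ b → b ≤ 1 → b ≤ a + n * δ → Φ a ≤ Φ b := by
    intro n
    induction n with
    | zero =>
      intro a b _ hab _ hba
      have : a = b := le_antisymm hab (by simpa using hba)
      rw [this]
    | succ n ih =>
      intro a b ha hab hb hba
      push_cast at hba
      have hstep : ∀ c, a ≤ c → c ≤ 1 → c ≤ a + δ → Φ a ≤ Φ c := by
        intro c hac hc1 hca
        have h3 := measureReal_arc_add m hm ha hac (by linarith)
        have h4 := measureReal_arc_add (m.map f.symm) hm' ha hac (by linarith)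
        have h5 := hshort a c hac hca
        simp only [hΦ]
        linarith
      rcases le_total b (a + δ) with h6 | h6
      · exact hstep b hab hb h6
      · exact (hstep (a + δ) (by linarith) (by linarith) le_rfl).trans
          (ih _ _ (by linarith) h6 hb (by linarith))
  have hmono : ∀ a b : ℝ, 0 ≤ a → a ≤ b → b ≤ 1 → Φ a ≤ Φ b := by
    intro a b ha hab hb
    obtain ⟨n, hn⟩ := exists_nat_ge ((b - a) / δ)
    rw [div_le_iff₀ hδ] at hn
    exact hloc n a b ha hab hb (by linarith)
  have hΦ0 : Φ 0 = 0 := by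
    simp only [hΦ, arc_self, measureReal_def, hm, hm', ENNReal.toReal_zero, sub_self]
  have hΦ1 : Φ 1 = 0 := by
    have := arc_self_add_one 0
    rw [zero_add] at this
    simp only [hΦ]
    rw [this, probReal_univ, probReal_univ, sub_self]
  have hkey : m = m.map f.symm := by
    refine ext_of_arc m fun t h0 h1 => ?_
    have h3 : Φ t = 0 := le_antisymm (hΦ1 ▸ hmono t 1 h0 h1.le le_rfl)
      (hΦ0 ▸ hmono 0 t le_rfl h0 h1.le)
    exact (measureReal_eq_measureReal_iff).1 (sub_eq_zero.1 h3)
  calc m.map f = (m.map f.symm).map f := by rw [← hkey]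
    _ = m := by
      rw [Measure.map_map f.continuous.measurable hfm]
      have : (f : S1 → S1) ∘ f.symm = id := funext f.apply_symm_apply
      rw [this, Measure.map_id]

end Collapse

/-! ### Words in the support and proximal pairs. -/

section Proximality

variable {G : Subsemigroup HomeoS1} (ν : Measure G) [IsProbabilityMeasure ν]

/-- The monoid generated by the support of `ν`. -/
def words : Submonoid HomeoS1 := Submonoid.closure ((↑) '' (ν.support : Set G))

/-- Two points are proximal if some words bring them arbitrarily close to each other. -/
def Proximal (x y : S1) : Prop := ∀ η > 0, ∃ g ∈ words ν, dist (g x) (g y) < η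

theorem mem_words {g : G} (hg : g ∈ ν.support) : (g : HomeoS1) ∈ words ν :=
  Submonoid.subset_closure ⟨g, hg, rfl⟩

theorem support_nonempty : (ν.support : Set G).Nonempty :=
  Filter.nonempty_of_mem (f := ae ν) Measure.support_mem_ae

theorem ae_mem_words : ∀ᵐ g : G ∂ν, (g : HomeoS1) ∈ words ν := by
  filter_upwards [Measure.support_mem_ae (μ := ν)] with g hg using mem_words ν hg

theorem mem_support_of_ae {C : Set G} (hC : IsClosed C) (h : ∀ᵐ g : G ∂ν, g ∈ C) {g : G}
    (hg : g ∈ ν.support) : g ∈ C :=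
  Measure.support_subset_of_isClosed hC h hg

/-- Almost every letter lies in the support, so a lower bound along all words passes to
expectations. Applied to `distMap`, it turns non-proximality into a lower bound on expected
distances. -/
theorem le_iterate_avg {Φ : C(S1 × S1, ℝ)} {c : ℝ} (n : ℕ) {x y : S1}
    (h : ∀ g ∈ words ν, c ≤ Φ (g x, g y)) : c ≤ (avg ν (fwdPair G))^[n] Φ (x, y) := by
  induction n generalizing x y with
  | zero => exact h 1 (one_mem _)
  | succ n ih =>
    rw [Function.iterate_succ_apply', avg_apply]
    have h1 : c = ∫ _ : G, c ∂ν := by simp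
    rw [h1]
    refine integral_mono_ae (integrable_const _) (integrable_slice ν _ _ _) ?_
    filter_upwards [ae_mem_words ν] with g hg
    exact ih fun k hk => h (k * g) (mul_mem hk hg)

theorem isOpen_exists_word_lt (η : ℝ) :
    IsOpen {z : S1 × S1 | ∃ g ∈ words ν, dist (g z.1) (g z.2) < η} := by
  have : {z : S1 × S1 | ∃ g ∈ words ν, dist (g z.1) (g z.2) < η} =
      ⋃ g ∈ words ν, {z : S1 × S1 | dist (g z.1) (g z.2) < η} := by
    ext z; simp
  rw [this]
  refine isOpen_biUnion fun g _ => isOpen_lt ?_ continuous_const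
  exact (g.continuous.comp continuous_fst).dist (g.continuous.comp continuous_snd)

/-- A pair in the orbit closure of a non-proximal pair is non-proximal. -/
theorem Proximal.of_mem_closure {x y : S1} {z : S1 × S1}
    (hz : z ∈ closure {w : S1 × S1 | ∃ g ∈ words ν, w = (g x, g y)})
    (h : Proximal ν z.1 z.2) : Proximal ν x y := fun η hη => by
  obtain ⟨w, hw, g, hg, rfl⟩ :=
    mem_closure_iff.1 hz _ (isOpen_exists_word_lt ν η) (h η hη)
  obtain ⟨k, hk, hd⟩ := hw
  exact ⟨k * g, mul_mem hk hg, hd⟩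

end Proximality

/-! ### A superharmonic potential on pairs of points. -/

section Potential

variable {G : Subsemigroup HomeoS1} {ν : Measure G} [IsProbabilityMeasure ν]
  {m : ProbabilityMeasure S1}

theorem IsBackwardLimit.singleton (hm : IsBackwardLimit ν m) (x : S1) :
    (m : Measure S1) {x} = 0 :=
  singleton_eq_zero_of_closedBall_le _ hm.closedBall_le x

theorem IsBackwardLimit.continuous_collapse (hm : IsBackwardLimit ν m) :
    Continuous (collapse (m : Measure S1)) :=
  CircleWalk.continuous_collapse _ hm.closedBall_le

/-- The distance of two points after collapsing. -/
noncomputable def cdist (m : ProbabilityMeasure S1) (x y : S1) : ℝ :=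
  dist (collapse (m : Measure S1) x) (collapse (m : Measure S1) y)

theorem cdist_nonneg (x y : S1) : 0 ≤ cdist m x y := dist_nonneg

theorem cdist_le_half (x y : S1) : cdist m x y ≤ 1 / 2 := by
  rw [cdist, dist_eq_norm]
  have := AddCircle.norm_le_half_period
    (x := collapse (m : Measure S1) x - collapse (m : Measure S1) y) 1 one_ne_zero
  rwa [abs_one] at this

theorem IsBackwardLimit.continuous_cdist (hm : IsBackwardLimit ν m) :
    Continuous fun z : S1 × S1 => cdist m z.1 z.2 :=
  (hm.continuous_collapse.comp continuous_fst).dist (hm.continuous_collapse.comp continuous_snd)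

theorem IsBackwardLimit.continuous_cdist_comp (hm : IsBackwardLimit ν m) {Y : Type*}
    [TopologicalSpace Y] {p q : Y → S1} (hp : Continuous p) (hq : Continuous q) :
    Continuous fun y => cdist m (p y) (q y) :=
  (hm.continuous_collapse.comp hp).dist (hm.continuous_collapse.comp hq)

/-- The potential of a pair of points: the product of the masses of the two arcs they bound. -/
noncomputable def potential (hm : IsBackwardLimit ν m) : C(S1 × S1, ℝ) :=
  ⟨fun z => cdist m z.1 z.2 * (1 - cdist m z.1 z.2),
    hm.continuous_cdist.mul (continuous_const.sub hm.continuous_cdist)⟩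

theorem potential_apply (hm : IsBackwardLimit ν m) (x y : S1) :
    potential hm (x, y) = cdist m x y * (1 - cdist m x y) := rfl

theorem potential_nonneg (hm : IsBackwardLimit ν m) (z : S1 × S1) : 0 ≤ potential hm z := by
  have h1 := cdist_nonneg (m := m) z.1 z.2
  have h2 := cdist_le_half (m := m) z.1 z.2
  change 0 ≤ cdist m z.1 z.2 * (1 - cdist m z.1 z.2)
  exact mul_nonneg h1 (by linarith)

theorem cdist_eq_of_potential_eq (hm : IsBackwardLimit ν m) {x y x' y' : S1}
    (h : potential hm (x, y) = potential hm (x', y')) : cdist m x y = cdist m x' y' := by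
  rw [potential_apply, potential_apply] at h
  have h1 := cdist_le_half (m := m) x y
  have h2 := cdist_le_half (m := m) x' y'
  rcases eq_or_ne (cdist m x y) (cdist m x' y') with h3 | h3
  · exact h3
  -- `t ↦ t (1 - t)` is injective on `[0, 1/2]`: the second factor can vanish only if both distances
  -- are `1/2`.
  have h4 : (cdist m x y - cdist m x' y') * (1 - cdist m x y - cdist m x' y') = 0 := by linarith
  rcases mul_eq_zero.1 h4 with h5 | h5 <;> linarith

/-- The symmetry of `t (1 - t)` under `t ↦ 1 - t` makes the choice between the two complementary
arcs irrelevant. The potential is thus a function of pairs of points that can be computed from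
either arc. -/
theorem potential_arc (hm : IsBackwardLimit ν m) {a b : ℝ} (hab : a ≤ b) (hb : b < a + 1) :
    potential hm (a, b) =
      (m : Measure S1).real (arc a b) * (1 - (m : Measure S1).real (arc a b)) := by
  rw [potential_apply, cdist, dist_comm, dist_eq_norm, collapse_sub _ hm.singleton hab hb]
  exact norm_coe_mul_one_sub measureReal_nonneg measureReal_le_one

theorem potential_swap (hm : IsBackwardLimit ν m) (x y : S1) :
    potential hm (x, y) = potential hm (y, x) := by
  rw [potential_apply, potential_apply, cdist, dist_comm]
  rfl

theorem potential_image (hm : IsBackwardLimit ν m) {a b : ℝ} (hab : a ≤ b) (hb : b < a + 1)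
    (f : HomeoS1) : potential hm (f a, f b) =
      (m : Measure S1).real (f '' arc a b) * (1 - (m : Measure S1).real (f '' arc a b)) := by
  obtain ⟨c, d, hcd, hdc, himg, hends⟩ := image_arc f hab hb
  rw [himg, ← potential_arc hm hcd hdc]
  rcases hends with ⟨h1, h2⟩ | ⟨h1, h2⟩
  · rw [h1, h2]
  · rw [h1, h2, potential_swap]

theorem measurable_measure_image (m : ProbabilityMeasure S1) {A : Set S1} (hA : IsClosed A) :
    Measurable fun g : G => (m : Measure S1) ((g : HomeoS1) '' A) := by
  have h1 : MeasurableSet ((bwd G) ⁻¹' A) := (bwd G).continuous.measurable hA.measurableSet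
  have h2 := measurable_measure_prodMk_left (ν := (m : Measure S1)) h1
  have h3 : (fun g : G => (m : Measure S1) ((g : HomeoS1) '' A)) =
      fun g : G => (m : Measure S1) (Prod.mk g ⁻¹' ((bwd G) ⁻¹' A)) := by
    funext g
    rw [Homeomorph.image_eq_preimage_symm]
    rfl
  rwa [h3]

theorem measurable_measureReal_image (m : ProbabilityMeasure S1) {A : Set S1} (hA : IsClosed A) :
    Measurable fun g : G => (m : Measure S1).real ((g : HomeoS1) '' A) :=
  (measurable_measure_image m hA).ennreal_toReal

theorem IsBackwardLimit.integral_image (hm : IsBackwardLimit ν m) {A : Set S1} (hA : IsClosed A) :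
    ∫ g : G, (m : Measure S1).real ((g : HomeoS1) '' A) ∂ν = (m : Measure S1).real A := by
  have h1 := push_bwd_apply ν m hA.measurableSet
  rw [hm.push_eq] at h1
  rw [measureReal_def, h1]
  exact integral_toReal (measurable_measure_image m hA).aemeasurable
    (ae_of_all _ fun g => measure_lt_top _ _)

/-- By backward stationarity the mass `X` of the image arc has mean `τ`, and `τ (1 - τ) - E[X (1 -
X)]` is then the variance of `X`. -/
theorem integral_potential (hm : IsBackwardLimit ν m) {a b : ℝ} (hab : a ≤ b) (hb : b < a + 1) :
    ∫ g : G, ((m : Measure S1).real ((g : HomeoS1) '' arc a b) -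
      (m : Measure S1).real (arc a b)) ^ 2 ∂ν =
      potential hm (a, b) - avg ν (fwdPair G) (potential hm) (a, b) := by
  set τ := (m : Measure S1).real (arc a b) with hτ
  set X : G → ℝ := fun g => (m : Measure S1).real ((g : HomeoS1) '' arc a b) with hX
  have hXm : Measurable X := measurable_measureReal_image m (isClosed_arc a b)
  have hXi : Integrable X ν := by
    refine Integrable.of_bound (C := 1) hXm.aestronglyMeasurable (ae_of_all _ fun g => ?_)
    rw [Real.norm_eq_abs, abs_of_nonneg measureReal_nonneg]
    exact measureReal_le_one
  have hmean : ∫ g, X g ∂ν = τ := hm.integral_image (isClosed_arc a b)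
  have h1 : avg ν (fwdPair G) (potential hm) (a, b) = ∫ g, X g * (1 - X g) ∂ν := by
    rw [avg_apply]
    exact integral_congr_ae (ae_of_all _ fun g => potential_image hm hab hb g)
  have h2i : Integrable (fun g => X g * (1 - X g)) ν := by
    refine Integrable.of_bound (C := 1) (hXm.mul (measurable_const.sub hXm)).aestronglyMeasurable
      (ae_of_all _ fun g => ?_)
    have h3 : 0 ≤ X g := measureReal_nonneg
    have h4 : X g ≤ 1 := measureReal_le_one
    rw [Real.norm_eq_abs, abs_le]
    constructor <;> nlinarith
  have h5 : ∀ g, (X g - τ) ^ 2 = (1 - 2 * τ) * X g + τ ^ 2 - X g * (1 - X g) := fun g => by ring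
  change ∫ g, (X g - τ) ^ 2 ∂ν = _
  simp only [h5]
  have hi : Integrable (fun g => (1 - 2 * τ) * X g + τ ^ 2) ν :=
    (hXi.const_mul _).add (integrable_const _)
  rw [integral_sub hi h2i,
    integral_add (hXi.const_mul _) (integrable_const _), integral_const_mul, hmean, ← h1,
    potential_arc hm hab hb]
  simp only [integral_const, probReal_univ, one_smul]
  ring

/-- The potential is superharmonic for the action on pairs. -/
theorem avg_potential_le (hm : IsBackwardLimit ν m) (z : S1 × S1) :
    avg ν (fwdPair G) (potential hm) z ≤ potential hm z := by
  obtain ⟨a, b, hab, hb, h1, h2⟩ := exists_rep_le z.1 z.2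
  have h3 := integral_potential hm hab hb
  have h4 : z = ((a : S1), (b : S1)) := Prod.ext h1.symm h2.symm
  rw [h4]
  have h5 : 0 ≤ ∫ g : G, ((m : Measure S1).real ((g : HomeoS1) '' arc a b) -
      (m : Measure S1).real (arc a b)) ^ 2 ∂ν := integral_nonneg fun g => sq_nonneg _
  linarith

/-- Where the potential is harmonic, almost every element preserves it. -/
theorem ae_potential_eq (hm : IsBackwardLimit ν m) (z : S1 × S1)
    (h : avg ν (fwdPair G) (potential hm) z = potential hm z) :
    ∀ᵐ g : G ∂ν, potential hm ((g : HomeoS1) z.1, (g : HomeoS1) z.2) = potential hm z := by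
  obtain ⟨a, b, hab, hb, h1, h2⟩ := exists_rep_le z.1 z.2
  have h3 := integral_potential hm hab hb
  have h4 : z = ((a : S1), (b : S1)) := Prod.ext h1.symm h2.symm
  rw [h4] at h ⊢
  rw [h, sub_self, integral_eq_zero_iff_of_nonneg (fun g => sq_nonneg _)] at h3
  · filter_upwards [h3] with g hg
    have h5 := pow_eq_zero_iff two_ne_zero |>.1 hg
    rw [potential_image hm hab hb, potential_arc hm hab hb, sub_eq_zero.1 h5]
  · refine Integrable.of_bound (C := 1)
      (((measurable_measureReal_image m (isClosed_arc a b)).sub_const _).pow_const 2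
        ).aestronglyMeasurable (ae_of_all _ fun g => ?_)
    have h5 : 0 ≤ (m : Measure S1).real ((g : HomeoS1) '' arc a b) := measureReal_nonneg
    have h6 : (m : Measure S1).real ((g : HomeoS1) '' arc a b) ≤ 1 := measureReal_le_one
    have h7 : 0 ≤ (m : Measure S1).real (arc a b) := measureReal_nonneg
    have h8 : (m : Measure S1).real (arc a b) ≤ 1 := measureReal_le_one
    rw [Real.norm_eq_abs, abs_of_nonneg (sq_nonneg _)]
    nlinarith

/-- Pairs of zero potential are proximal. -/
theorem proximal_of_potential_eq_zero (hm : IsBackwardLimit ν m) {x y : S1}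
    (h : potential hm (x, y) = 0) : Proximal ν x y := by
  obtain ⟨a, b, hab, hb, rfl, rfl⟩ := exists_rep_le x y
  intro η hη
  by_contra! hcon
  have hd : ∀ n, η ≤ (avg ν (fwdPair G))^[n] distMap ((a : S1), (b : S1)) := fun n =>
    le_iterate_avg ν n hcon
  -- If words kept `x` and `y` at distance `η`, every arc containing both would have image of
  -- expected length at least `η` at all times, hence positive mass. This applies to both
  -- complementary arcs, so the potential would be positive.
  have hpos : ∀ c d : ℝ, (a : S1) ∈ arc c d → (b : S1) ∈ arc c d →
      η ≤ (m : Measure S1).real (arc c d) := by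
    intro c d hac hbc
    refine hm.le_of_le_lam _ _ (isClosed_arc c d) fun n => ?_
    have h1 := ofReal_iterate_distMap_le ν n (isClosed_arc c d) (isPreconnected_arc c d) hac hbc
    have h2 := (ENNReal.ofReal_le_ofReal (hd n)).trans h1
    exact (ENNReal.ofReal_le_iff_le_toReal (measure_ne_top _ _)).1 h2
  have h1 := hpos a b ⟨a, ⟨le_rfl, hab⟩, rfl⟩ ⟨b, ⟨hab, le_rfl⟩, rfl⟩
  have h2 := hpos b (a + 1)
    ⟨a + 1, ⟨hb.le, le_rfl⟩, by simp⟩ ⟨b, ⟨le_rfl, hb.le⟩, rfl⟩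
  have h3 := measureReal_arc_add (m : Measure S1) hm.singleton hab hb.le le_rfl
  rw [arc_self_add_one, probReal_univ] at h3
  rw [potential_arc hm hab hb] at h
  have h4 : 0 < (m : Measure S1).real (arc a b) * (1 - (m : Measure S1).real (arc a b)) :=
    mul_pos (by linarith) (by linarith)
  linarith

end Potential

/-! ### Closed invariant sets and minimal ones. -/

section MinimalSets

variable {G : Subsemigroup HomeoS1} (ν : Measure G) [IsProbabilityMeasure ν]

/-- Nonempty closed sets mapped into themselves by the support of `ν`. -/
structure IsInvariantSet (Z : Set S1) : Prop where
  isClosed : IsClosed Z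
  nonempty : Z.Nonempty
  mapsTo : ∀ g ∈ ν.support, ∀ x ∈ Z, (g : HomeoS1) x ∈ Z

/-- Minimal nonempty closed invariant sets. -/
structure IsMinimalSet (K : Set S1) : Prop extends IsInvariantSet ν K where
  eq_of_subset : ∀ Z ⊆ K, IsInvariantSet ν Z → Z = K

variable {ν}

theorem IsInvariantSet.word_mem {Z : Set S1} (hZ : IsInvariantSet ν Z) {g : HomeoS1}
    (hg : g ∈ words ν) : ∀ x ∈ Z, g x ∈ Z := by
  induction hg using Submonoid.closure_induction with
  | mem g hg =>
    obtain ⟨g, hg, rfl⟩ := hg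
    exact hZ.mapsTo g hg
  | one => exact fun x hx => hx
  | mul g k _ _ h1 h2 => exact fun x hx => h1 _ (h2 x hx)

theorem IsInvariantSet.exists_minimal {Z : Set S1} (hZ : IsInvariantSet ν Z) :
    ∃ K ⊆ Z, IsMinimalSet ν K := by
  obtain ⟨K, hKZ, hK⟩ := zorn_superset_nonempty {Z : Set S1 | IsInvariantSet ν Z} (by
    intro c hc hchain hne
    refine ⟨⋂₀ c, ⟨isClosed_sInter fun s hs => (hc hs).isClosed, ?_, ?_⟩,
      fun s hs => Set.sInter_subset_of_mem hs⟩
    · have : Nonempty c := hne.to_subtype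
      rw [Set.sInter_eq_iInter]
      refine IsCompact.nonempty_iInter_of_directed_nonempty_isCompact_isClosed _ ?_
        (fun s => (hc s.2).nonempty) (fun s => (hc s.2).isClosed.isCompact)
        (fun s => (hc s.2).isClosed)
      intro s t
      rcases hchain.total s.2 t.2 with h | h
      · exact ⟨s, subset_rfl, h⟩
      · exact ⟨t, h, subset_rfl⟩
    · exact fun g hg x hx s hs => (hc hs).mapsTo g hg x (hx s hs)) Z hZ
  exact ⟨K, hKZ, ⟨hK.prop, fun Y hY hYinv => hK.eq_of_subset hYinv hY⟩⟩

end MinimalSets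

/-! ### Rigid configurations, and proximal pairs among close points. -/

section Rigidity

variable {G : Subsemigroup HomeoS1} {ν : Measure G} [IsProbabilityMeasure ν]
  {m : ProbabilityMeasure S1}

theorem continuous_word_pair (Φ : C(S1 × S1, ℝ)) (z : S1 × S1) :
    Continuous fun g : G => Φ ((g : HomeoS1) z.1, (g : HomeoS1) z.2) :=
  Φ.continuous.comp ((fwdPair G).continuous.comp (by fun_prop : Continuous fun g : G => (g, z)))

/-- Where the potential is harmonic, the support preserves it. -/
theorem potential_eq_of_mem_support (hm : IsBackwardLimit ν m) (z : S1 × S1)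
    (h : potential hm z ≤ avg ν (fwdPair G) (potential hm) z) {g : G} (hg : g ∈ ν.support) :
    potential hm ((g : HomeoS1) z.1, (g : HomeoS1) z.2) = potential hm z :=
  mem_support_of_ae ν (C := {g : G | potential hm ((g : HomeoS1) z.1, (g : HomeoS1) z.2) =
    potential hm z}) (isClosed_eq (continuous_word_pair _ z) continuous_const)
    (ae_potential_eq hm z (le_antisymm (avg_potential_le hm z) h)) hg

/-- A nonnegative superharmonic function is harmonic at its zeros, so the support preserves them.
Words therefore descend to the collapsed circle. -/
theorem cdist_word_eq_zero (hm : IsBackwardLimit ν m) {g : HomeoS1} (hg : g ∈ words ν) :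
    ∀ x y : S1, cdist m x y = 0 → cdist m (g x) (g y) = 0 := by
  induction hg using Submonoid.closure_induction with
  | mem g hg =>
    obtain ⟨g, hg, rfl⟩ := hg
    intro x y h
    have h0 : potential hm (x, y) = 0 := by rw [potential_apply, h, zero_mul]
    have h1 := potential_eq_of_mem_support hm (x, y)
      (h0.le.trans (integral_nonneg fun g => potential_nonneg hm _)) hg
    rw [← h]
    exact cdist_eq_of_potential_eq hm h1
  | one => exact fun x y h => h
  | mul g k _ _ h1 h2 => exact fun x y h => h1 _ _ (h2 x y h)

/-- The sum of the potentials of the three pairs in a triple. -/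
noncomputable def triplePotential (hm : IsBackwardLimit ν m) (w : S1 × S1 × S1) : ℝ :=
  potential hm (w.1, w.2.1) + potential hm (w.2.1, w.2.2) + potential hm (w.1, w.2.2)

theorem continuous_triplePotential (hm : IsBackwardLimit ν m) :
    Continuous (triplePotential hm) := by
  unfold triplePotential
  fun_prop

/-- The diagonal action on triples. -/
def tripleMap (g : HomeoS1) (w : S1 × S1 × S1) : S1 × S1 × S1 := (g w.1, g w.2.1, g w.2.2)

theorem continuous_tripleMap (g : HomeoS1) : Continuous (tripleMap g) :=
  (g.continuous.comp continuous_fst).prodMk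
    ((g.continuous.comp (continuous_fst.comp continuous_snd)).prodMk
      (g.continuous.comp (continuous_snd.comp continuous_snd)))

/-- The closure of the orbit of a triple. -/
def tripleOrbit (ν : Measure G) (w : S1 × S1 × S1) : Set (S1 × S1 × S1) :=
  closure {u | ∃ g ∈ words ν, u = tripleMap g w}

theorem self_mem_tripleOrbit (w : S1 × S1 × S1) : w ∈ tripleOrbit ν w :=
  subset_closure ⟨1, one_mem _, rfl⟩

theorem tripleMap_mem_tripleOrbit {w u : S1 × S1 × S1} {g : HomeoS1} (hg : g ∈ words ν)
    (hu : u ∈ tripleOrbit ν w) : tripleMap g u ∈ tripleOrbit ν w := by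
  refine map_mem_closure (continuous_tripleMap g) hu ?_
  rintro _ ⟨k, hk, rfl⟩
  exact ⟨g * k, mul_mem hg hk, rfl⟩

theorem tripleOrbit_subset {K : Set S1} (hK : IsInvariantSet ν K) {w : S1 × S1 × S1}
    (hw : w ∈ K ×ˢ K ×ˢ K) : tripleOrbit ν w ⊆ K ×ˢ K ×ˢ K := by
  refine closure_minimal ?_ (hK.isClosed.prod (hK.isClosed.prod hK.isClosed))
  rintro _ ⟨g, hg, rfl⟩
  exact ⟨hK.word_mem hg _ hw.1, hK.word_mem hg _ hw.2.1, hK.word_mem hg _ hw.2.2⟩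

/-- At a minimiser of the triple potential on an orbit closure all three potentials are rigid. -/
theorem rigid_of_isMinOn (hm : IsBackwardLimit ν m) {w : S1 × S1 × S1} {g : HomeoS1}
    (hg : g ∈ words ν) : ∀ u ∈ tripleOrbit ν w, IsMinOn (triplePotential hm) (tripleOrbit ν w) u →
      IsMinOn (triplePotential hm) (tripleOrbit ν w) (tripleMap g u) ∧
      potential hm (g u.1, g u.2.1) = potential hm (u.1, u.2.1) ∧
      potential hm (g u.2.1, g u.2.2) = potential hm (u.2.1, u.2.2) ∧
      potential hm (g u.1, g u.2.2) = potential hm (u.1, u.2.2) := by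
  induction hg using Submonoid.closure_induction with
  | one => exact fun u _ hmin => ⟨hmin, rfl, rfl, rfl⟩
  | mul g k _ hk h1 h2 =>
    intro u hu hmin
    obtain ⟨h3, h4, h5, h6⟩ := h2 u hu hmin
    obtain ⟨h7, h8, h9, h10⟩ := h1 _ (tripleMap_mem_tripleOrbit hk hu) h3
    exact ⟨h7, h8.trans h4, h9.trans h5, h10.trans h6⟩
  | mem g hg =>
    obtain ⟨g, hg, rfl⟩ := hg
    intro u hu hmin
    -- Minimality on the orbit closure bounds the sum of averages below; superharmonicity bounds
    -- each average above. All three are therefore equalities.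
    have h1 : triplePotential hm u ≤ avg ν (fwdPair G) (potential hm) (u.1, u.2.1) +
        avg ν (fwdPair G) (potential hm) (u.2.1, u.2.2) +
        avg ν (fwdPair G) (potential hm) (u.1, u.2.2) := by
      have i1 := integrable_slice ν (fwdPair G) (potential hm) (u.1, u.2.1)
      have i2 := integrable_slice ν (fwdPair G) (potential hm) (u.2.1, u.2.2)
      have i3 := integrable_slice ν (fwdPair G) (potential hm) (u.1, u.2.2)
      have i12 : Integrable (fun g => potential hm (fwdPair G (g, u.1, u.2.1)) +
        potential hm (fwdPair G (g, u.2.1, u.2.2))) ν := i1.add i2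
      rw [avg_apply, avg_apply, avg_apply, ← integral_add i1 i2, ← integral_add i12 i3]
      have h2 : triplePotential hm u = ∫ _ : G, triplePotential hm u ∂ν := by simp
      rw [h2]
      refine integral_mono_ae (integrable_const _) (i12.add i3) ?_
      filter_upwards [ae_mem_words ν] with k hk
      have h4 := isMinOn_iff.1 hmin _ (tripleMap_mem_tripleOrbit hk hu)
      unfold triplePotential at h4 ⊢
      exact h4
    have a1 := avg_potential_le hm (u.1, u.2.1)
    have a2 := avg_potential_le hm (u.2.1, u.2.2)
    have a3 := avg_potential_le hm (u.1, u.2.2)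
    have h1' : potential hm (u.1, u.2.1) + potential hm (u.2.1, u.2.2) +
      potential hm (u.1, u.2.2) ≤ _ := h1
    have e1 := potential_eq_of_mem_support hm (u.1, u.2.1) (by linarith) hg
    have e2 := potential_eq_of_mem_support hm (u.2.1, u.2.2) (by linarith) hg
    have e3 := potential_eq_of_mem_support hm (u.1, u.2.2) (by linarith) hg
    refine ⟨fun v hv => ?_, e1, e2, e3⟩
    have h3 : triplePotential hm (tripleMap g u) = triplePotential hm u := by
      unfold triplePotential
      exact congrArg₂ _ (congrArg₂ _ e1 e2) e3
    rw [Set.mem_ofPred_eq, h3]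
    exact hmin hv

/-- Non-proximal triples yield rigid triples of non-proximal pairs with smaller potential. -/
theorem exists_rigid_triple (hm : IsBackwardLimit ν m) {K : Set S1} (hK : IsInvariantSet ν K)
    {w : S1 × S1 × S1} (hw : w ∈ K ×ˢ K ×ˢ K) (h1 : ¬ Proximal ν w.1 w.2.1)
    (h2 : ¬ Proximal ν w.2.1 w.2.2) (h3 : ¬ Proximal ν w.1 w.2.2) :
    ∃ u ∈ K ×ˢ K ×ˢ K, triplePotential hm u ≤ triplePotential hm w ∧
      0 < cdist m u.1 u.2.1 ∧ 0 < cdist m u.2.1 u.2.2 ∧ 0 < cdist m u.1 u.2.2 ∧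
      ∀ g ∈ words ν, cdist m (g u.1) (g u.2.1) = cdist m u.1 u.2.1 ∧
        cdist m (g u.2.1) (g u.2.2) = cdist m u.2.1 u.2.2 ∧
        cdist m (g u.1) (g u.2.2) = cdist m u.1 u.2.2 := by
  obtain ⟨u, hu, hmin⟩ := (isClosed_closure.isCompact : IsCompact (tripleOrbit ν w)).exists_isMinOn
    ⟨w, self_mem_tripleOrbit w⟩ (continuous_triplePotential hm).continuousOn
  -- The minimiser does not degenerate: a pair of zero potential in it would be proximal, and so
  -- would the original pair.
  have hpos : ∀ (p q : S1 × S1 × S1 → S1), Continuous p → Continuous q →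
      (∀ (g : HomeoS1) v, p (tripleMap g v) = g (p v)) →
      (∀ (g : HomeoS1) v, q (tripleMap g v) = g (q v)) →
      ¬ Proximal ν (p w) (q w) → 0 < cdist m (p u) (q u) := by
    intro p q hp hq hpg hqg hprox
    refine lt_of_le_of_ne (cdist_nonneg _ _) fun h0 => hprox ?_
    have h4 : Proximal ν (p u) (q u) :=
      proximal_of_potential_eq_zero hm (by rw [potential_apply, ← h0, zero_mul])
    refine Proximal.of_mem_closure ν (z := (p u, q u)) ?_ h4
    refine map_mem_closure (f := fun v => (p v, q v)) (hp.prodMk hq) hu ?_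
    rintro _ ⟨g, hg, rfl⟩
    exact ⟨g, hg, Prod.ext (hpg g w) (hqg g w)⟩
  refine ⟨u, tripleOrbit_subset hK hw hu, hmin (self_mem_tripleOrbit w), ?_, ?_, ?_, ?_⟩
  · exact hpos (fun v => v.1) (fun v => v.2.1) (by fun_prop) (by fun_prop) (fun _ _ => rfl)
      (fun _ _ => rfl) h1
  · exact hpos (fun v => v.2.1) (fun v => v.2.2) (by fun_prop) (by fun_prop) (fun _ _ => rfl)
      (fun _ _ => rfl) h2
  · exact hpos (fun v => v.1) (fun v => v.2.2) (by fun_prop) (by fun_prop) (fun _ _ => rfl)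
      (fun _ _ => rfl) h3
  · intro g hg
    obtain ⟨-, e1, e2, e3⟩ := rigid_of_isMinOn hm hg u hu hmin
    exact ⟨cdist_eq_of_potential_eq hm e1, cdist_eq_of_potential_eq hm e2,
      cdist_eq_of_potential_eq hm e3⟩

theorem exists_coe_abs_eq_norm (A : S1) : ∃ t : ℝ, (t : S1) = A ∧ |t| = ‖A‖ := by
  obtain ⟨a, t, ha, hat, ht⟩ := exists_rep_dist 0 A
  refine ⟨t, ?_, by rw [ht, dist_zero_left]⟩
  rw [AddCircle.coe_add, ha, zero_add] at hat
  exact hat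

/-- Among three close points of the circle one lies between the other two. -/
theorem exists_between (p q r : S1) (h1 : dist p q ≤ 1 / 4) (h2 : dist p r ≤ 1 / 4) :
    dist q r = dist p q + dist p r ∨ dist p q = dist p r + dist q r ∨
      dist p r = dist p q + dist q r := by
  obtain ⟨α, hα, hα'⟩ := exists_coe_abs_eq_norm (q - p)
  obtain ⟨β, hβ, hβ'⟩ := exists_coe_abs_eq_norm (r - p)
  have d1 : dist p q = |α| := by rw [hα', dist_comm, dist_eq_norm]
  have d2 : dist p r = |β| := by rw [hβ', dist_comm, dist_eq_norm]
  rw [d1] at h1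
  rw [d2] at h2
  have h3 : dist q r = |β - α| := by
    rw [dist_comm, dist_eq_norm]
    have : r - q = ((β - α : ℝ) : S1) := by rw [AddCircle.coe_sub, hα, hβ]; abel
    rw [this, norm_coe_eq_abs]
    have := abs_sub β α
    linarith
  rw [h3, d1, d2]
  grind

/-- A rigid configuration: two points at fixed distances on either side of the point `p`, after
collapsing. -/
def IsRigidAt (ν : Measure G) (m : ProbabilityMeasure S1) (s t : ℝ) (p a b : S1) : Prop :=
  ∀ g ∈ words ν, cdist m (g p) (g a) = s ∧ cdist m (g p) (g b) = t ∧
    cdist m (g a) (g b) = s + t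

theorem cdist_comm (x y : S1) : cdist m x y = cdist m y x := dist_comm _ _

theorem le_of_potential_le (hm : IsBackwardLimit ν m) {x y : S1} {ε : ℝ}
    (h : potential hm (x, y) ≤ ε / 2) : cdist m x y ≤ ε := by
  have h1 := cdist_nonneg (m := m) x y
  have h2 := cdist_le_half (m := m) x y
  rw [potential_apply] at h
  nlinarith

theorem potential_le_cdist (hm : IsBackwardLimit ν m) (x y : S1) :
    potential hm (x, y) ≤ cdist m x y := by
  have h1 := cdist_nonneg (m := m) x y
  rw [potential_apply]
  nlinarith

/-- Close points have small potential, and minimising only lowers it, so the rigid triple is small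
on the collapsed circle. Its middle point serves as `p`; the other two lie on opposite sides of it.
-/
theorem exists_isRigidAt (hm : IsBackwardLimit ν m) {K : Set S1} (hK : IsInvariantSet ν K)
    (hcon : ∀ ε > 0, ∃ x ∈ K, ∃ y ∈ K, ∃ z ∈ K, dist x y < ε ∧ dist y z < ε ∧ dist x z < ε ∧
      ¬ Proximal ν x y ∧ ¬ Proximal ν y z ∧ ¬ Proximal ν x z) {ε : ℝ} (hε : 0 < ε) :
    ∃ p ∈ K, ∃ a ∈ K, ∃ b ∈ K, ∃ s t : ℝ, 0 < s ∧ s ≤ ε ∧ 0 < t ∧ t ≤ ε ∧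
      IsRigidAt ν m s t p a b := by
  -- The bound `1/4` allows betweenness on the circle to be read on the line; `η / 6` for each of
  -- the three pairs keeps the total potential below `η / 2`.
  set η := min ε (1 / 4) with hη
  have hη0 : 0 < η := by positivity
  obtain ⟨δ, hδ, hu⟩ := Metric.uniformContinuous_iff.1
    (CompactSpace.uniformContinuous_of_continuous hm.continuous_collapse) (η / 6) (by positivity)
  obtain ⟨x, hx, y, hy, z, hz, hxy, hyz, hxz, h1, h2, h3⟩ := hcon δ hδ
  obtain ⟨⟨p, q, r⟩, ⟨hp, hq, hr⟩, hle, d1, d2, d3, hrig⟩ :=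
    exists_rigid_triple hm hK (w := (x, y, z)) ⟨hx, hy, hz⟩ h1 h2 h3
  dsimp only at hp hq hr d1 d2 d3 hrig
  have hV : triplePotential hm (x, y, z) ≤ η / 2 := by
    have e1 := (potential_le_cdist hm x y).trans (hu hxy).le
    have e2 := (potential_le_cdist hm y z).trans (hu hyz).le
    have e3 := (potential_le_cdist hm x z).trans (hu hxz).le
    unfold triplePotential
    dsimp only
    linarith
  have hV' : potential hm (p, q) + potential hm (q, r) + potential hm (p, r) ≤ η / 2 :=
    hle.trans hV
  have n1 := potential_nonneg hm (p, q)
  have n2 := potential_nonneg hm (q, r)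
  have n3 := potential_nonneg hm (p, r)
  have b1 : cdist m p q ≤ η := le_of_potential_le hm (by linarith)
  have b2 : cdist m q r ≤ η := le_of_potential_le hm (by linarith)
  have b3 : cdist m p r ≤ η := le_of_potential_le hm (by linarith)
  have hηε : η ≤ ε := min_le_left _ _
  have hη4 : η ≤ 1 / 4 := min_le_right _ _
  rcases exists_between (collapse (m : Measure S1) p) (collapse (m : Measure S1) q)
    (collapse (m : Measure S1) r) (b1.trans hη4) (b3.trans hη4) with h | h | h
  · refine ⟨p, hp, q, hq, r, hr, _, _, d1, b1.trans hηε, d3, b3.trans hηε, fun g hg => ?_⟩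
    obtain ⟨r1, r2, r3⟩ := hrig g hg
    exact ⟨r1, r3, r2.trans h⟩
  · refine ⟨r, hr, p, hp, q, hq, _, _, d3, b3.trans hηε, d2, b2.trans hηε, fun g hg => ?_⟩
    obtain ⟨r1, r2, r3⟩ := hrig g hg
    exact ⟨(cdist_comm _ _).trans r3, (cdist_comm _ _).trans r2, r1.trans h⟩
  · refine ⟨q, hq, p, hp, r, hr, _, _, d1, b1.trans hηε, d2, b2.trans hηε, fun g hg => ?_⟩
    obtain ⟨r1, r2, r3⟩ := hrig g hg
    exact ⟨(cdist_comm _ _).trans r1, r2, r3.trans h⟩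

theorem isClosed_isRigidAt (hm : IsBackwardLimit ν m) (s t : ℝ) :
    IsClosed {w : S1 × S1 × S1 | IsRigidAt ν m s t w.1 w.2.1 w.2.2} := by
  have : {w : S1 × S1 × S1 | IsRigidAt ν m s t w.1 w.2.1 w.2.2} =
      ⋂ g ∈ words ν, {w | cdist m (g w.1) (g w.2.1) = s ∧ cdist m (g w.1) (g w.2.2) = t ∧
        cdist m (g w.2.1) (g w.2.2) = s + t} := by
    ext w; simp [IsRigidAt]
  rw [this]
  refine isClosed_biInter fun g _ => ?_
  have hc : ∀ p q : S1 × S1 × S1 → S1, Continuous p → Continuous q →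
      Continuous fun w => cdist m (g (p w)) (g (q w)) := fun p q hp hq =>
    hm.continuous_cdist_comp (g.continuous.comp hp) (g.continuous.comp hq)
  have c1 : IsClosed {w : S1 × S1 × S1 | cdist m (g w.1) (g w.2.1) = s} :=
    isClosed_eq (hc (fun w => w.1) (fun w => w.2.1) (by fun_prop) (by fun_prop)) continuous_const
  have c2 : IsClosed {w : S1 × S1 × S1 | cdist m (g w.1) (g w.2.2) = t} :=
    isClosed_eq (hc (fun w => w.1) (fun w => w.2.2) (by fun_prop) (by fun_prop)) continuous_const
  have c3 : IsClosed {w : S1 × S1 × S1 | cdist m (g w.2.1) (g w.2.2) = s + t} :=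
    isClosed_eq (hc (fun w => w.2.1) (fun w => w.2.2) (by fun_prop) (by fun_prop)) continuous_const
  have e := c1.inter (c2.inter c3)
  rwa [← Set.ofPred_and, ← Set.ofPred_and] at e

/-- Rigidity passes to the orbit closure of the triple, whose first projection is closed and
invariant in `K`, hence all of `K` by minimality. -/
theorem exists_isRigidAt_of_mem (hm : IsBackwardLimit ν m) {K : Set S1} (hK : IsMinimalSet ν K)
    {p a b : S1} {s t : ℝ} (hp : p ∈ K) (ha : a ∈ K) (hb : b ∈ K)
    (hrig : IsRigidAt ν m s t p a b) {x : S1} (hx : x ∈ K) :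
    ∃ a' ∈ K, ∃ b' ∈ K, IsRigidAt ν m s t x a' b' := by
  have hsub := tripleOrbit_subset hK.toIsInvariantSet (w := (p, a, b)) ⟨hp, ha, hb⟩
  have horb : tripleOrbit ν (p, a, b) ⊆ {w | IsRigidAt ν m s t w.1 w.2.1 w.2.2} := by
    refine closure_minimal ?_ (isClosed_isRigidAt hm s t)
    rintro _ ⟨g, hg, rfl⟩
    exact fun k hk => hrig (k * g) (mul_mem hk hg)
  have hproj : Prod.fst '' tripleOrbit ν (p, a, b) = K := by
    refine hK.eq_of_subset _ ?_ ⟨?_, ⟨p, _, self_mem_tripleOrbit _, rfl⟩, ?_⟩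
    · rintro _ ⟨w, hw, rfl⟩
      exact (hsub hw).1
    · exact ((isClosed_closure.isCompact : IsCompact (tripleOrbit ν (p, a, b))).image
        continuous_fst).isClosed
    · rintro g hg _ ⟨w, hw, rfl⟩
      exact ⟨_, tripleMap_mem_tripleOrbit (mem_words ν hg) hw, rfl⟩
  rw [← hproj] at hx
  obtain ⟨⟨x, a', b'⟩, hw, rfl⟩ := hx
  exact ⟨a', (hsub hw).2.1, b', (hsub hw).2.2, horb hw⟩

/-- A rigid configuration provides a rigid step in the positive direction. -/
theorem exists_positive_step {K : Set S1} {x a b : S1} {s t ε : ℝ} (ha : a ∈ K) (hb : b ∈ K)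
    (hs : 0 < s) (hsε : s ≤ ε) (ht : 0 < t) (htε : t ≤ ε) (h : IsRigidAt ν m s t x a b) :
    ∃ y ∈ K, ∃ ρ : ℝ, 0 < ρ ∧ ρ ≤ ε ∧
      collapse (m : Measure S1) y = collapse (m : Measure S1) x + (ρ : S1) ∧
      ∀ g ∈ words ν, cdist m (g x) (g y) = ρ := by
  obtain ⟨h1, h2, h3⟩ : cdist m x a = s ∧ cdist m x b = t ∧ cdist m a b = s + t :=
    h 1 (one_mem _)
  obtain ⟨α, hα, hα'⟩ :=
    exists_coe_abs_eq_norm (collapse (m : Measure S1) a - collapse (m : Measure S1) x)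
  obtain ⟨β, hβ, hβ'⟩ :=
    exists_coe_abs_eq_norm (collapse (m : Measure S1) b - collapse (m : Measure S1) x)
  rw [← dist_eq_norm, dist_comm] at hα' hβ'
  change |α| = cdist m x a at hα'
  change |β| = cdist m x b at hβ'
  rw [h1] at hα'
  rw [h2] at hβ'
  rcases le_or_gt α 0 with hα0 | hα0
  · rcases le_or_gt β 0 with hβ0 | hβ0
    -- With both points on the same side, their distance would be less than `s + t`. This is why
    -- triples rather than pairs are used: one of the two points is always in the positive
    -- direction.
    · exfalso
      have h4 : cdist m a b = ‖((α - β : ℝ) : S1)‖ := by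
        rw [cdist, dist_eq_norm, AddCircle.coe_sub, hα, hβ, sub_sub_sub_cancel_right]
      have h5 := norm_coe_le_abs (α - β)
      rw [← h4, h3] at h5
      rw [abs_of_nonpos hα0] at hα'
      rw [abs_of_nonpos hβ0] at hβ'
      have : |α - β| < s + t := abs_lt.2 ⟨by linarith, by linarith⟩
      linarith
    · rw [abs_of_pos hβ0] at hβ'
      refine ⟨b, hb, t, ht, htε, ?_, fun g hg => (h g hg).2.1⟩
      rw [← hβ', hβ, add_sub_cancel]
  · rw [abs_of_pos hα0] at hα'
    refine ⟨a, ha, s, hs, hsε, ?_, fun g hg => (h g hg).1⟩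
    rw [← hα', hα, add_sub_cancel]

/-- Arbitrarily small rigid steps in the positive direction allow to reach every position. -/
theorem exists_collapse_eq_add (hm : IsBackwardLimit ν m) {K : Set S1} (hK : IsInvariantSet ν K)
    (hstep : ∀ ε > 0, ∀ x ∈ K, ∃ y ∈ K, ∃ ρ : ℝ, 0 < ρ ∧ ρ ≤ ε ∧
      collapse (m : Measure S1) y = collapse (m : Measure S1) x + (ρ : S1) ∧
      ∀ g ∈ words ν, cdist m (g x) (g y) = ρ)
    {f : HomeoS1} (hf : f ∈ words ν) {x : S1} (hx : x ∈ K) {ρ : ℝ} (hρ : ρ ∈ Set.Icc (0 : ℝ) 1) :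
    ∃ y ∈ K, collapse (m : Measure S1) y = collapse (m : Measure S1) x + (ρ : S1) ∧
      cdist m (f x) (f y) ≤ ρ := by
  set T : Set ℝ := {ρ | ∃ y ∈ K,
    collapse (m : Measure S1) y = collapse (m : Measure S1) x + (ρ : S1) ∧
      cdist m (f x) (f y) ≤ ρ} with hT
  set P : Set (ℝ × S1) := {q | collapse (m : Measure S1) q.2 =
    collapse (m : Measure S1) x + (q.1 : S1) ∧ cdist m (f x) (f q.2) ≤ q.1} with hP
  have hc : IsClosed P := by
    have c1 : IsClosed {q : ℝ × S1 | collapse (m : Measure S1) q.2 =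
        collapse (m : Measure S1) x + (q.1 : S1)} :=
      isClosed_eq (hm.continuous_collapse.comp continuous_snd)
        (continuous_const.add (continuous_coe.comp continuous_fst))
    have c2 : Continuous fun q : ℝ × S1 => cdist m (f x) (f q.2) :=
      hm.continuous_cdist_comp continuous_const (f.continuous.comp continuous_snd)
    have e := c1.inter (isClosed_le c2 continuous_fst)
    rwa [← Set.ofPred_and] at e
  have hclosed : IsClosed (T ∩ Set.Icc 0 1) := by
    have himg : T ∩ Set.Icc 0 1 = Prod.fst '' (((Set.Icc (0 : ℝ) 1) ×ˢ K) ∩ P) := by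
      ext r
      constructor
      · rintro ⟨⟨y, hy, h1⟩, hr⟩
        exact ⟨(r, y), ⟨⟨hr, hy⟩, h1⟩, rfl⟩
      · rintro ⟨⟨r, y⟩, ⟨⟨hr, hy⟩, h1⟩, rfl⟩
        exact ⟨⟨y, hy, h1⟩, hr⟩
    rw [himg]
    exact (((isCompact_Icc.prod hK.isClosed.isCompact).inter_right hc).image
      continuous_fst).isClosed
  -- The reachable displacements form a closed set containing `0` and extendable by arbitrarily
  -- small steps. The bound on the image adds up because each step keeps its length under `f`.
  refine hclosed.Icc_subset_of_forall_exists_gt ⟨x, hx, by simp, by simp [cdist]⟩ ?_ hρ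
  rintro r ⟨⟨y, hy, h1, h2⟩, -⟩ r' hr'
  obtain ⟨y', hy', σ, hσ0, hσ, h3, h4⟩ := hstep (r' - r) (sub_pos.2 hr') y hy
  refine ⟨r + σ, ⟨y', hy', ?_, ?_⟩, by linarith, by linarith⟩
  · rw [h3, h1, AddCircle.coe_add, add_assoc]
  · refine (dist_triangle _ (collapse (m : Measure S1) (f y)) _).trans ?_
    exact add_le_add h2 (h4 f hf).le

theorem cdist_word_le (hm : IsBackwardLimit ν m) {K : Set S1} (hK : IsInvariantSet ν K)
    (hstep : ∀ ε > 0, ∀ x ∈ K, ∃ y ∈ K, ∃ ρ : ℝ, 0 < ρ ∧ ρ ≤ ε ∧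
      collapse (m : Measure S1) y = collapse (m : Measure S1) x + (ρ : S1) ∧
      ∀ g ∈ words ν, cdist m (g x) (g y) = ρ)
    {f : HomeoS1} (hf : f ∈ words ν) (x y : S1) : cdist m (f x) (f y) ≤ cdist m x y := by
  -- Every displacement being reachable inside `K`, the set `K` collapses onto the whole circle;
  -- since words respect the fibres, arbitrary points may be replaced by points of `K`.
  have hK' : ∀ z : S1, ∃ z' ∈ K, collapse (m : Measure S1) z' = collapse (m : Measure S1) z := by
    intro z
    obtain ⟨x₀, hx₀⟩ := hK.nonempty
    have hr := rep_mem (collapse (m : Measure S1) z - collapse (m : Measure S1) x₀)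
    obtain ⟨z', hz', h, -⟩ := exists_collapse_eq_add hm hK hstep hf hx₀ ⟨hr.1, hr.2.le⟩
    refine ⟨z', hz', ?_⟩
    rw [h, coe_rep, add_sub_cancel]
  have hzero : ∀ z z' : S1, collapse (m : Measure S1) z' = collapse (m : Measure S1) z →
      collapse (m : Measure S1) (f z') = collapse (m : Measure S1) (f z) := fun z z' h =>
    dist_eq_zero.1 (cdist_word_eq_zero hm hf z' z (dist_eq_zero.2 h))
  have hpos : ∀ x y : S1, ∀ t : ℝ, 0 ≤ t →
      (t : S1) = collapse (m : Measure S1) y - collapse (m : Measure S1) x →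
      t = cdist m x y → cdist m (f x) (f y) ≤ t := by
    intro x y t h0 h1 h2
    obtain ⟨x', hx', hxx'⟩ := hK' x
    have ht1 : t ≤ 1 := by
      have := cdist_le_half (m := m) x y
      linarith
    obtain ⟨y', hy', h3, h4⟩ := exists_collapse_eq_add hm hK hstep hf hx' ⟨h0, ht1⟩
    have h5 : collapse (m : Measure S1) y' = collapse (m : Measure S1) y := by
      rw [h3, h1, hxx', add_sub_cancel]
    rw [cdist, hzero x x' hxx', hzero y y' h5] at h4
    exact h4
  obtain ⟨t, ht, ht'⟩ :=
    exists_coe_abs_eq_norm (collapse (m : Measure S1) y - collapse (m : Measure S1) x)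
  rw [← dist_eq_norm, dist_comm] at ht'
  rcases le_total 0 t with h0 | h0
  · rw [abs_of_nonneg h0] at ht'
    exact (hpos x y t h0 ht ht').trans ht'.le
  · rw [abs_of_nonpos h0] at ht'
    rw [cdist_comm, cdist_comm x y]
    refine (hpos y x (-t) (by linarith) ?_ (ht'.trans (dist_comm _ _))).trans
      (ht'.trans (dist_comm _ _)).le
    rw [AddCircle.coe_neg, ht, neg_sub]

/-- Three close points of a minimal set contain a proximal pair. -/
theorem exists_proximal_pair (hν : NonDegenerate ν)
    (hinv : ¬ ∃ μ : ProbabilityMeasure S1, Preserves G (μ : Measure S1))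
    {K : Set S1} (hK : IsMinimalSet ν K) : ∃ ε > 0, ∀ x ∈ K, ∀ y ∈ K, ∀ z ∈ K,
      dist x y < ε → dist y z < ε → dist x z < ε →
      Proximal ν x y ∨ Proximal ν y z ∨ Proximal ν x z := by
  by_contra! hcon
  obtain ⟨m, hm⟩ := exists_isBackwardLimit hν hinv
  have hstep : ∀ ε > 0, ∀ x ∈ K, ∃ y ∈ K, ∃ ρ : ℝ, 0 < ρ ∧ ρ ≤ ε ∧
      collapse (m : Measure S1) y = collapse (m : Measure S1) x + (ρ : S1) ∧
      ∀ g ∈ words ν, cdist m (g x) (g y) = ρ := by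
    intro ε hε x hx
    obtain ⟨p, hp, a, ha, b, hb, s, t, hs, hsε, ht, htε, hrig⟩ :=
      exists_isRigidAt hm hK.toIsInvariantSet hcon hε
    obtain ⟨a', ha', b', hb', h⟩ := exists_isRigidAt_of_mem hm hK hp ha hb hrig hx
    exact exists_positive_step ha' hb' hs hsε ht htε h
  -- Small steps exist at every point of `K`, so words do not expand collapsed distances and `m` is
  -- invariant, against the hypothesis.
  refine hinv ⟨m, preserves_of_ae hν m fun φ => ?_⟩
  filter_upwards [ae_mem_words ν] with g hg
  have h1 := map_eq_of_dist_collapse_le (m : Measure S1) hm.closedBall_le (g : HomeoS1)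
    (cdist_word_le hm hK.toIsInvariantSet hstep hg)
  conv_rhs => rw [← h1]
  rw [integral_map (g : HomeoS1).continuous.measurable.aemeasurable
    φ.continuous.aestronglyMeasurable]

end Rigidity

/-! ### Recurrent functions are fixed by the averaging operator. -/

section Recurrence

variable {G : Subsemigroup HomeoS1} {ν : Measure G} [IsProbabilityMeasure ν]

theorem integral_iterate_push (μ : ProbabilityMeasure S1) (φ : C(S1, ℝ)) (n : ℕ) :
    ∫ x, φ x ∂((push ν (fwd G))^[n] μ : Measure S1) =
      ∫ x, (avg ν (fwd G))^[n] φ x ∂(μ : Measure S1) := by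
  induction n generalizing φ with
  | zero => rfl
  | succ n ih => rw [Function.iterate_succ_apply', integral_push, ih, Function.iterate_succ_apply]

theorem iterate_avg_eq_zero {Z : Set S1} (hZ : IsInvariantSet ν Z) {φ : C(S1, ℝ)}
    (hφ : ∀ x ∈ Z, φ x = 0) (n : ℕ) : ∀ x ∈ Z, (avg ν (fwd G))^[n] φ x = 0 := by
  induction n with
  | zero => exact hφ
  | succ n ih =>
    intro x hx
    rw [Function.iterate_succ_apply', avg_apply]
    refine integral_eq_zero_of_ae ?_
    filter_upwards [ae_mem_words ν] with g hg
    exact ih _ (hZ.word_mem hg x hx)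

/-- Stationarity puts `g x` in the support for almost all `x` and `g`; closedness of the support
upgrades this to every `g` in `ν.support` and every `x` in the support. -/
theorem isInvariantSet_support {μ : ProbabilityMeasure S1} (hμ : push ν (fwd G) μ = μ) :
    IsInvariantSet ν (μ : Measure S1).support := by
  refine ⟨Measure.isClosed_support, Filter.nonempty_of_mem (f := ae (μ : Measure S1))
    Measure.support_mem_ae, ?_⟩
  set C := (μ : Measure S1).support with hC
  have h1 : ∀ᵐ x ∂(push ν (fwd G) μ : Measure S1), x ∈ C := by
    rw [hμ]
    exact Measure.support_mem_ae
  rw [coe_push] at h1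
  have h2 := ae_of_ae_map (fwd G).continuous.measurable.aemeasurable h1
  have h3 : ∀ᵐ q ∂((μ : Measure S1).prod ν), fwd G (q.2, q.1) ∈ C := by
    have := Measure.measurePreserving_swap (μ := (μ : Measure S1)) (ν := ν)
    exact this.quasiMeasurePreserving.ae h2
  have h4 := Measure.ae_ae_of_ae_prod h3
  have h5 : ∀ᵐ x ∂(μ : Measure S1), x ∈ {x | ∀ g ∈ ν.support, (g : HomeoS1) x ∈ C} := by
    filter_upwards [h4] with x hx g hg
    refine mem_support_of_ae ν (C := {g : G | (g : HomeoS1) x ∈ C}) ?_ hx hg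
    exact Measure.isClosed_support.preimage
      ((fwd G).continuous.comp (by fun_prop : Continuous fun g : G => (g, x)))
  have h6 : IsClosed {x | ∀ g ∈ ν.support, (g : HomeoS1) x ∈ C} := by
    have : {x | ∀ g ∈ ν.support, (g : HomeoS1) x ∈ C} =
        ⋂ g ∈ ν.support, (g : HomeoS1) ⁻¹' C := by ext x; simp
    rw [this]
    exact isClosed_biInter fun g _ => Measure.isClosed_support.preimage (g : HomeoS1).continuous
  exact fun g hg x hx => Measure.support_subset_of_isClosed h6 h5 hx g hg

/-- A minimal set is the support of a stationary measure. -/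
theorem IsMinimalSet.exists_stationary {K : Set S1} (hK : IsMinimalSet ν K) :
    ∃ μ : ProbabilityMeasure S1, push ν (fwd G) μ = μ ∧ (μ : Measure S1).support = K := by
  obtain ⟨x₀, hx₀⟩ := hK.nonempty
  let ρ : ℕ → ProbabilityMeasure S1 := fun n => (push ν (fwd G))^[n] ⟨Measure.dirac x₀, inferInstance⟩
  have hρ : ∀ n (φ : C(S1, ℝ)), ∫ x, φ x ∂(ρ n : Measure S1) = (avg ν (fwd G))^[n] φ x₀ :=
    fun n φ => (integral_iterate_push _ φ n).trans (integral_dirac _ _)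
  obtain ⟨μ, hμ⟩ := exists_cesaro_limit ρ
  have hstat : push ν (fwd G) μ = μ := by
    refine probabilityMeasure_ext fun φ => ?_
    rw [integral_push]
    refine cesaro_shift (fun n => integral_mem_bounds (ρ n) φ) (hμ φ) ?_
    refine (hμ (avg ν (fwd G) φ)).congr fun n => ?_
    simp only [hρ, ← Function.iterate_succ_apply]
  refine ⟨μ, hstat, hK.eq_of_subset _ ?_ (isInvariantSet_support hstat)⟩
  refine Measure.support_subset_of_isClosed hK.isClosed ?_
  let φ : C(S1, ℝ) := ⟨fun x => Metric.infDist x K, Metric.continuous_infDist_pt K⟩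
  have hφ : ∀ x ∈ K, φ x = 0 := fun x hx => Metric.infDist_zero_of_mem hx
  have h0 : ∫ x, φ x ∂(μ : Measure S1) = 0 := by
    refine tendsto_nhds_unique (hμ φ) ?_
    simp only [hρ, iterate_avg_eq_zero hK.toIsInvariantSet hφ _ x₀ hx₀, Finset.sum_const_zero,
      zero_div]
    exact tendsto_const_nhds
  have hφ0 : ∀ x, 0 ≤ φ x := fun x => Metric.infDist_nonneg
  rw [integral_eq_zero_iff_of_nonneg hφ0 (integrable_of_continuous _ φ)] at h0
  filter_upwards [h0] with x hx
  exact (hK.isClosed.mem_iff_infDist_zero hK.nonempty).2 hx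

theorem continuous_integral_continuousMap (μ : ProbabilityMeasure S1) :
    Continuous fun φ : C(S1, ℝ) => ∫ x, φ x ∂(μ : Measure S1) := by
  refine LipschitzWith.continuous (K := 1) (LipschitzWith.of_dist_le_mul fun φ ψ => ?_)
  rw [NNReal.coe_one, one_mul, dist_eq_norm φ ψ, Real.dist_eq,
    ← integral_sub (integrable_of_continuous _ φ) (integrable_of_continuous _ ψ)]
  exact integral_mem_bounds μ (φ - ψ)

/-- Functions that keep returning close to themselves under the averaging operator. -/
def IsRecurrent (ν : Measure G) [IsProbabilityMeasure ν] (ψ : C(S1, ℝ)) : Prop :=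
  ∀ ε > 0, ∀ N : ℕ, ∃ n ≥ N, dist ((avg ν (fwd G))^[n] ψ) ψ < ε

theorem integral_sq_sub_avg (χ : C(S1, ℝ)) (x : S1) :
    ∫ g : G, (χ ((g : HomeoS1) x) - avg ν (fwd G) χ x) ^ 2 ∂ν =
      avg ν (fwd G) (χ * χ) x - (avg ν (fwd G) χ x) ^ 2 := by
  set τ := avg ν (fwd G) χ x with hτ
  have h1 : ∀ g : G, (χ ((g : HomeoS1) x) - τ) ^ 2 =
      ((χ * χ) (fwd G (g, x)) - 2 * τ * χ (fwd G (g, x))) + τ ^ 2 := fun g => by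
    rw [ContinuousMap.mul_apply, fwd_apply]
    ring
  simp only [h1]
  have i1 := integrable_slice ν (fwd G) (χ * χ) x
  have i2 := (integrable_slice ν (fwd G) χ x).const_mul (2 * τ)
  have i12 : Integrable (fun g => (χ * χ) (fwd G (g, x)) - 2 * τ * χ (fwd G (g, x))) ν :=
    i1.sub i2
  rw [integral_add i12 (integrable_const _), integral_sub i1 i2, integral_const_mul,
    ← avg_apply, ← avg_apply, ← hτ, integral_const, probReal_univ, one_smul]
  ring

/-- On a minimal set a recurrent function evolves deterministically. -/
theorem IsRecurrent.iterate_apply {ψ : C(S1, ℝ)} (hψ : IsRecurrent ν ψ) {K : Set S1}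
    (hK : IsMinimalSet ν K) (n : ℕ) {x : S1} (hx : x ∈ K) {g : G} (hg : g ∈ ν.support) :
    (avg ν (fwd G))^[n] ψ ((g : HomeoS1) x) = (avg ν (fwd G))^[n + 1] ψ x := by
  obtain ⟨μ, hμ, hsupp⟩ := hK.exists_stationary
  set P := avg ν (fwd G) with hP
  set e : C(S1, ℝ) → ℝ := fun χ => ∫ x, (χ * χ) x ∂(μ : Measure S1) with he
  have hcont : Continuous e :=
    (continuous_integral_continuousMap μ).comp (continuous_id.mul continuous_id)
  -- By stationarity, the loss of `L²` energy under `P` is the integral of the variances of `g ↦ χ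
  -- (g x)`.
  have hdiff : ∀ χ, e χ - e (P χ) = ∫ x, (P (χ * χ) - P χ * P χ) x ∂(μ : Measure S1) := by
    intro χ
    have h1 : e χ = ∫ x, P (χ * χ) x ∂(μ : Measure S1) := by
      rw [← integral_push, hμ]
    rw [h1, he, ← integral_sub (integrable_of_continuous _ _) (integrable_of_continuous _ _)]
    rfl
  have hvar : ∀ χ x, 0 ≤ (P (χ * χ) - P χ * P χ) x := by
    intro χ x
    have h1 := integral_sq_sub_avg (ν := ν) χ x
    have h2 : 0 ≤ ∫ g : G, (χ ((g : HomeoS1) x) - P χ x) ^ 2 ∂ν :=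
      integral_nonneg fun g => sq_nonneg _
    rw [h1] at h2
    rw [ContinuousMap.sub_apply, ContinuousMap.mul_apply, ← sq (P χ x)]
    exact h2
  have hanti : Antitone fun n => e (P^[n] ψ) := by
    refine antitone_nat_of_succ_le fun n => ?_
    rw [Function.iterate_succ_apply']
    have h1 := hdiff (P^[n] ψ)
    have h2 : 0 ≤ ∫ x, (P (P^[n] ψ * P^[n] ψ) - P (P^[n] ψ) * P (P^[n] ψ)) x ∂(μ : Measure S1) :=
      integral_nonneg fun x => hvar _ x
    linarith
  -- A strict loss of energy is never regained, whereas recurrence brings later iterates arbitrarily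
  -- close to `ψ`.
  have heq : e (P^[n + 1] ψ) = e (P^[n] ψ) := by
    refine le_antisymm (hanti (Nat.le_succ n)) (le_of_not_gt fun hlt => ?_)
    have h1 : e (P^[n + 1] ψ) < e ψ := hlt.trans_le (hanti (Nat.zero_le n))
    obtain ⟨δ, hδ, h2⟩ := Metric.mem_nhds_iff.1
      (hcont.continuousAt.eventually (lt_mem_nhds h1) : ∀ᶠ χ in 𝓝 ψ, e (P^[n + 1] ψ) < e χ)
    obtain ⟨j, hj, h3⟩ := hψ δ hδ (n + 1)
    exact absurd (h2 h3) (not_lt.2 (hanti hj))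
  set χ := P^[n] ψ with hχ
  rw [Function.iterate_succ_apply', ← hχ] at heq ⊢
  have h0 : ∫ x, (P (χ * χ) - P χ * P χ) x ∂(μ : Measure S1) = 0 := by
    rw [← hdiff, heq, sub_self]
  rw [integral_eq_zero_iff_of_nonneg (hvar χ) (integrable_of_continuous _ _)] at h0
  have h1 : (P (χ * χ) - P χ * P χ) x = 0 := by
    have hcl : IsClosed {x | (P (χ * χ) - P χ * P χ) x = 0} :=
      isClosed_eq (ContinuousMap.continuous _) continuous_const
    rw [← hsupp] at hx
    exact Measure.support_subset_of_isClosed hcl h0 hx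
  have h2 := integral_sq_sub_avg (ν := ν) χ x
  rw [ContinuousMap.sub_apply, ContinuousMap.mul_apply, ← sq (P χ x)] at h1
  have hc : Continuous fun g : G => χ ((g : HomeoS1) x) :=
    χ.continuous.comp ((fwd G).continuous.comp (by fun_prop : Continuous fun g : G => (g, x)))
  rw [h1, integral_eq_zero_iff_of_nonneg (fun g => sq_nonneg _)] at h2
  · refine mem_support_of_ae ν (C := {g : G | χ ((g : HomeoS1) x) = P χ x})
      (isClosed_eq hc continuous_const) ?_ hg
    filter_upwards [h2] with g hg
    exact sub_eq_zero.1 (pow_eq_zero_iff two_ne_zero |>.1 hg)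
  · refine Integrable.of_bound (C := (2 * ‖χ‖) ^ 2)
      ((hc.sub continuous_const).pow 2).aestronglyMeasurable (ae_of_all _ fun g => ?_)
    rw [norm_pow]
    gcongr
    have h3 := χ.norm_coe_le_norm ((g : HomeoS1) x)
    have h4 := ((P χ).norm_coe_le_norm x).trans (norm_avg_le ν (fwd G) χ)
    have h5 := norm_sub_le (χ ((g : HomeoS1) x)) (P χ x)
    linarith

/-- The exponent `k` is a length of the word and does not depend on the point: two points of `K`
moved by the same word are delayed by the same amount. -/
theorem IsRecurrent.iterate_word {ψ : C(S1, ℝ)} (hψ : IsRecurrent ν ψ) {K : Set S1}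
    (hK : IsMinimalSet ν K) {g : HomeoS1} (hg : g ∈ words ν) :
    ∃ k, ∀ n, ∀ x ∈ K, (avg ν (fwd G))^[n] ψ (g x) = (avg ν (fwd G))^[n + k] ψ x := by
  induction hg using Submonoid.closure_induction with
  | mem g hg =>
    obtain ⟨g, hg, rfl⟩ := hg
    exact ⟨1, fun n x hx => hψ.iterate_apply hK n hx hg⟩
  | one => exact ⟨0, fun n x hx => rfl⟩
  | mul g k _ hk h1 h2 =>
    obtain ⟨i, hi⟩ := h1
    obtain ⟨j, hj⟩ := h2
    refine ⟨i + j, fun n x hx => ?_⟩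
    have h3 := hi n (k x) (hK.word_mem hk x hx)
    rw [← add_assoc, ← hj _ x hx, ← h3]
    rfl

theorem IsRecurrent.dist_iterate {ψ : C(S1, ℝ)} (hψ : IsRecurrent ν ψ) {ε : ℝ} (hε : 0 < ε)
    (N : ℕ) : ∃ j ≥ N, ∀ n x,
      |(avg ν (fwd G))^[n + j] ψ x - (avg ν (fwd G))^[n] ψ x| < ε := by
  obtain ⟨j, hj, h⟩ := hψ ε hε N
  refine ⟨j, hj, fun n x => ?_⟩
  rw [Function.iterate_add_apply, ← Real.dist_eq]
  exact (ContinuousMap.dist_apply_le_dist x).trans_lt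
    ((dist_iterate_avg_le ν (fwd G) _ _ n).trans_lt h)

/-- Recurrent functions do not separate proximal points of a minimal set. -/
theorem IsRecurrent.eq_of_proximal (hν : NonDegenerate ν)
    (hinv : ¬ ∃ μ : ProbabilityMeasure S1, Preserves G (μ : Measure S1))
    {ψ : C(S1, ℝ)} (hψ : IsRecurrent ν ψ) {K : Set S1} (hK : IsMinimalSet ν K) {x y : S1}
    (hx : x ∈ K) (hy : y ∈ K) (h : Proximal ν x y) (n : ℕ) :
    (avg ν (fwd G))^[n] ψ x = (avg ν (fwd G))^[n] ψ y := by
  rw [← sub_eq_zero, ← abs_nonpos_iff]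
  refine le_of_forall_pos_le_add fun ε hε => ?_
  obtain ⟨δ, hδ, hequi⟩ := exists_equicontinuity hν hinv ψ (ε := ε / 3) (by positivity)
  obtain ⟨g, hg, hd⟩ := h δ hδ
  obtain ⟨k, hk⟩ := hψ.iterate_word hK hg
  -- The return time is taken at least `k`, so that the delay caused by `g` can be completed to a
  -- full return.
  obtain ⟨j, hj, hrec⟩ := hψ.dist_iterate (ε := ε / 3) (by positivity) k
  have e1 := hequi (n + (j - k)) _ _ hd.le
  rw [hk _ x hx, hk _ y hy, show n + (j - k) + k = n + j by omega] at e1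
  have e2 := hrec n x
  have e3 := hrec n y
  rw [abs_le] at e1 ⊢
  rw [abs_lt] at e2 e3
  constructor <;> linarith [e1.1, e1.2, e2.1, e2.2, e3.1, e3.2]

/-- The hypothesis only gives periodicity from time `i` on; a return time `k ≥ i` carries it back to
all times. -/
theorem periodic_of_recurrent {a : ℕ → ℝ} (ha : ∀ ε > 0, ∀ N : ℕ, ∃ j ≥ N, ∀ n, |a (n + j) - a n| < ε)
    {i j : ℕ} (hij : i < j) (h : ∀ n, a (n + i) = a (n + j)) : Function.Periodic a (j - i) := by
  intro n
  rw [← sub_eq_zero, ← abs_nonpos_iff]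
  refine le_of_forall_pos_le_add fun ε hε => ?_
  obtain ⟨k, hk, hrec⟩ := ha (ε / 2) (by positivity) i
  have e1 := hrec n
  have e2 := hrec (n + (j - i))
  have e3 := h (n + (k - i))
  rw [show n + (k - i) + i = n + k by omega,
    show n + (k - i) + j = n + (j - i) + k by omega] at e3
  rw [← e3] at e2
  rw [abs_lt] at e1 e2
  rw [abs_le]
  constructor <;> linarith [e1.1, e1.2, e2.1, e2.2]

theorem exists_three_close (u : ℕ → S1) {ε : ℝ} (hε : 0 < ε) : ∃ i j k, i < j ∧ j < k ∧
    dist (u i) (u j) < ε ∧ dist (u j) (u k) < ε ∧ dist (u i) (u k) < ε := by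
  obtain ⟨l, -, φ, hφ, hl⟩ := isCompact_univ.tendsto_subseq (x := u) fun _ => trivial
  obtain ⟨N, hN⟩ := Metric.tendsto_atTop.1 hl (ε / 2) (by positivity)
  have hd : ∀ i ≥ N, ∀ j ≥ N, dist (u (φ i)) (u (φ j)) < ε := fun i hi j hj => by
    have h1 := dist_triangle_right (u (φ i)) (u (φ j)) l
    have h2 := hN i hi
    have h3 := hN j hj
    simp only [Function.comp_apply] at h2 h3
    linarith
  exact ⟨φ N, φ (N + 1), φ (N + 2), hφ (by omega), hφ (by omega), hd _ (by omega) _ (by omega),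
    hd _ (by omega) _ (by omega), hd _ (by omega) _ (by omega)⟩

/-- Recurrent functions are invariant on minimal sets of an indecomposable random walk. -/
theorem IsRecurrent.iterate_succ_eq (hν : NonDegenerate ν)
    (hinv : ¬ ∃ μ : ProbabilityMeasure S1, Preserves G (μ : Measure S1)) (hind : Indecomposable ν)
    {ψ : C(S1, ℝ)} (hψ : IsRecurrent ν ψ) {K : Set S1} (hK : IsMinimalSet ν K) {x : S1}
    (hx : x ∈ K) (n : ℕ) :
    (avg ν (fwd G))^[n + 1] ψ x = (avg ν (fwd G))^[n] ψ x := by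
  set a : ℕ → ℝ := fun n => (avg ν (fwd G))^[n] ψ x with ha
  obtain ⟨f, hf⟩ := support_nonempty ν
  have horb : ∀ i, (f : HomeoS1)^[i] x ∈ K := by
    intro i
    induction i with
    | zero => exact hx
    | succ i ih =>
      rw [Function.iterate_succ_apply']
      exact hK.mapsTo f hf _ ih
  have hval : ∀ i n, (avg ν (fwd G))^[n] ψ ((f : HomeoS1)^[i] x) = a (n + i) := by
    intro i
    induction i with
    | zero => exact fun n => rfl
    | succ i ih =>
      intro n
      rw [Function.iterate_succ_apply', hψ.iterate_apply hK n (horb i) hf, ih,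
        show n + 1 + i = n + (i + 1) by omega]
  have hrec : ∀ ε > 0, ∀ N : ℕ, ∃ j ≥ N, ∀ n, |a (n + j) - a n| < ε := fun ε hε N => by
    obtain ⟨j, hj, h⟩ := hψ.dist_iterate hε N
    exact ⟨j, hj, fun n => h n x⟩
  obtain ⟨ε, hε, hprox⟩ := exists_proximal_pair hν hinv hK
  obtain ⟨i, j, k, hij, hjk, d1, d2, d3⟩ := exists_three_close (fun i => (f : HomeoS1)^[i] x) hε
  have hper : ∃ p, 0 < p ∧ Function.Periodic a p := by
    have key : ∀ i j, i < j → Proximal ν ((f : HomeoS1)^[i] x) ((f : HomeoS1)^[j] x) →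
        ∃ p, 0 < p ∧ Function.Periodic a p := fun i j hij h =>
      ⟨j - i, by omega, periodic_of_recurrent hrec hij fun n => by
        rw [← hval, ← hval]
        exact hψ.eq_of_proximal hν hinv hK (horb i) (horb j) h n⟩
    rcases hprox _ (horb i) _ (horb j) _ (horb k) d1 d2 d3 with h | h | h
    · exact key i j hij h
    · exact key j k hjk h
    · exact key i k (hij.trans hjk) h
  classical
  obtain ⟨hp0, hp⟩ := Nat.find_spec hper
  have hmin : ∀ q, 0 < q → q < Nat.find hper → ¬ Function.Periodic a q := fun q h0 hq hq' =>
    Nat.find_min hper hq ⟨h0, hq'⟩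
  generalize Nat.find hper = p at hp0 hp hmin
  rcases Nat.lt_or_ge p 2 with hp2 | hp2
  · have : p = 1 := by omega
    subst this
    exact hp n
  exfalso
  have : NeZero p := ⟨by omega⟩
  -- The pieces are the points of `K` whose whole sequence of values is `a` shifted by `i`.
  -- Minimality of the period makes them disjoint, and one step of the walk advances the shift by
  -- one.
  refine hind ⟨p, fun i => {y | y ∈ K ∧ ∀ n, (avg ν (fwd G))^[n] ψ y = a (n + i.val)}, hp2,
    fun i => ?_, fun i => ⟨(f : HomeoS1)^[i.val] x, horb _, hval _⟩, fun i j hij => ?_, ?_⟩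
  · have h1 : IsClosed (⋂ n, {y | (avg ν (fwd G))^[n] ψ y = a (n + i.val)}) :=
      isClosed_iInter fun n => isClosed_eq (ContinuousMap.continuous _) continuous_const
    have h2 : {y | y ∈ K ∧ ∀ n, (avg ν (fwd G))^[n] ψ y = a (n + i.val)} =
        K ∩ ⋂ n, {y | (avg ν (fwd G))^[n] ψ y = a (n + i.val)} := by ext y; simp
    beta_reduce
    rw [h2]
    exact hK.isClosed.inter h1
  · rw [Set.disjoint_left]
    rintro y ⟨-, h1⟩ ⟨-, h2⟩
    have h3 : ∀ n, a (n + i.val) = a (n + j.val) := fun n => (h1 n).symm.trans (h2 n)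
    have hi := ZMod.val_lt i
    have hj := ZMod.val_lt j
    rcases lt_trichotomy i.val j.val with h | h | h
    · exact hmin (j.val - i.val) (by omega) (by omega) (periodic_of_recurrent hrec h h3)
    · exact hij (ZMod.val_injective p h)
    · exact hmin (i.val - j.val) (by omega) (by omega)
        (periodic_of_recurrent hrec h fun n => (h3 n).symm)
  · filter_upwards [Measure.support_mem_ae (μ := ν)] with g hg i
    rintro _ ⟨y, ⟨hy, h1⟩, rfl⟩
    refine ⟨hK.mapsTo g hg y hy, fun n => ?_⟩
    rw [hψ.iterate_apply hK n hy hg, h1]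
    have h2 := hp.map_mod_nat
    -- Periodicity absorbs the wrap-around of `i + 1` at `p`.
    have h3 : (n + (i + 1).val) % p = (n + 1 + i.val) % p := by
      rw [ZMod.val_add, ZMod.val_one'' (by omega)]
      rw [Nat.add_mod_mod]
      congr 1
      omega
    rw [← h2 (n + 1 + i.val), ← h3, h2]

/-- Recurrent functions are invariant. -/
theorem IsRecurrent.avg_eq (hν : NonDegenerate ν)
    (hinv : ¬ ∃ μ : ProbabilityMeasure S1, Preserves G (μ : Measure S1)) (hind : Indecomposable ν)
    {ψ : C(S1, ℝ)} (hψ : IsRecurrent ν ψ) : avg ν (fwd G) ψ = ψ := by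
  set P := avg ν (fwd G) with hP
  set D := P ψ - ψ with hD
  have hDn : ∀ n, P^[n] D = P^[n + 1] ψ - P^[n] ψ := fun n => by
    rw [hD, hP, iterate_avg_sub, Function.iterate_succ_apply]
  have hbound : ∀ n x, |P^[n] D x| ≤ ‖D‖ := fun n x =>
    ((P^[n] D).norm_coe_le_norm x).trans (norm_iterate_avg_le ν (fwd G) D n)
  have hbdd : ∀ x, BddAbove (Set.range fun n => |P^[n] D x|) := fun x =>
    ⟨‖D‖, by rintro _ ⟨n, rfl⟩; exact hbound n x⟩
  set S : S1 → ℝ := fun x => ⨆ n, |P^[n] D x| with hS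
  have hle : ∀ n x, |P^[n] D x| ≤ S x := fun n x => le_ciSup (hbdd x) n
  have hSle : ∀ x, S x ≤ ‖D‖ := fun x => ciSup_le fun n => hbound n x
  have hScont : Continuous S := by
    rw [Metric.continuous_iff]
    intro x ε hε
    obtain ⟨δ, hδ, hequi⟩ := exists_equicontinuity hν hinv D (ε := ε / 2) (by positivity)
    refine ⟨δ, hδ, fun y hy => ?_⟩
    have key : ∀ y z, dist y z ≤ δ → S y ≤ S z + ε / 2 := fun y z hyz => by
      refine ciSup_le fun n => ?_
      have h1 := hequi n y z hyz
      have h2 := abs_sub_abs_le_abs_sub (P^[n] D y) (P^[n] D z)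
      have h3 := hle n z
      linarith
    rw [Real.dist_eq, abs_lt]
    have h1 := key y x hy.le
    have h2 := key x y (by rw [dist_comm]; exact hy.le)
    constructor <;> linarith
  have hSint : ∀ x, Integrable (fun g : G => S ((g : HomeoS1) x)) ν := fun x =>
    integrable_slice ν (fwd G) ⟨S, hScont⟩ x
  -- `S` is subharmonic. The terms `n ≥ 1` are averages of values below `S`; the term `n = 0` is a
  -- limit of such terms, because recurrence of `ψ` makes `D` recurrent.
  have hsub : ∀ x, S x ≤ ∫ g : G, S ((g : HomeoS1) x) ∂ν := by
    intro x
    have hsucc : ∀ n, |P^[n + 1] D x| ≤ ∫ g : G, S ((g : HomeoS1) x) ∂ν := fun n => by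
      rw [Function.iterate_succ_apply']
      exact (abs_avg_le ν (fwd G) _ x).trans
        (integral_mono (integrable_slice ν (fwd G) _ x).abs (hSint x) fun g => hle n _)
    refine ciSup_le fun n => ?_
    rcases n with _ | n
    · refine le_of_forall_pos_le_add fun ε hε => ?_
      obtain ⟨j, hj, hrec⟩ := hψ.dist_iterate (ε := ε / 2) (by positivity) 1
      obtain ⟨i, rfl⟩ : ∃ i, j = i + 1 := ⟨j - 1, by omega⟩
      have h1 := hrec 0 x
      have h2 := hrec 1 x
      have h3 := hsucc i
      rw [hDn, ContinuousMap.sub_apply] at h3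
      rw [hDn, ContinuousMap.sub_apply]
      rw [show 0 + (i + 1) = i + 1 by omega, abs_lt] at h1
      rw [show 1 + (i + 1) = i + 1 + 1 by omega, abs_lt] at h2
      rw [abs_le] at h3 ⊢
      rw [zero_add]
      constructor <;> linarith [h1.1, h1.2, h2.1, h2.2, h3.1, h3.2]
    · exact hsucc n
  by_contra hne
  have hpos : 0 < ‖D‖ := norm_pos_iff.2 (sub_ne_zero.2 hne)
  -- Maximum principle: where the average of `S` attains its upper bound, almost every `g`, and by
  -- continuity the whole support, stays in the maximum set. A minimal set inside it contradicts `D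
  -- = 0` there.
  have hZ : IsInvariantSet ν {x | S x = ‖D‖} := by
    refine ⟨isClosed_eq hScont continuous_const, ?_, fun g hg x hx => ?_⟩
    · obtain ⟨x, -, hx⟩ := isCompact_univ.exists_isMaxOn Set.univ_nonempty
        (D.continuous.norm.continuousOn (s := Set.univ))
      refine ⟨x, le_antisymm (hSle x) (((ContinuousMap.norm_le _ (norm_nonneg _)).2
        fun y => isMaxOn_iff.1 hx y trivial).trans (hle 0 x))⟩
    · have hx' : S x = ‖D‖ := hx
      refine mem_support_of_ae ν (C := {g : G | S ((g : HomeoS1) x) = ‖D‖}) ?_ ?_ hg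
      · exact isClosed_eq (hScont.comp
          ((fwd G).continuous.comp (by fun_prop : Continuous fun g : G => (g, x)))) continuous_const
      · have h1 : ∫ g : G, (‖D‖ - S ((g : HomeoS1) x)) ∂ν = 0 := by
          rw [integral_sub (integrable_const _) (hSint x), integral_const, probReal_univ, one_smul]
          have h2 := hsub x
          have h3 : ∫ g : G, S ((g : HomeoS1) x) ∂ν ≤ ∫ _ : G, ‖D‖ ∂ν :=
            integral_mono (hSint x) (integrable_const _) fun g => hSle _
          rw [integral_const, probReal_univ, one_smul] at h3
          linarith
        rw [integral_eq_zero_iff_of_nonneg (fun g => sub_nonneg.2 (hSle _))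
          ((integrable_const _).sub (hSint x))] at h1
        filter_upwards [h1] with g hg
        exact (sub_eq_zero.1 hg).symm
  obtain ⟨K, hKZ, hK⟩ := hZ.exists_minimal
  obtain ⟨x, hx⟩ := hK.nonempty
  have h1 : S x = ‖D‖ := hKZ hx
  have h2 : S x = 0 := by
    have : ∀ n, |P^[n] D x| = 0 := fun n => by
      rw [hDn, ContinuousMap.sub_apply, hψ.iterate_succ_eq hν hinv hind hK hx n, sub_self, abs_zero]
    simp only [hS, this, ciSup_const]
  linarith

end Recurrence

/-! ### Uniform convergence of the iterates. -/

section Convergence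

variable {G : Subsemigroup HomeoS1} {ν : Measure G} [IsProbabilityMeasure ν]

/-- The forward orbit of a function under the averaging operator is relatively compact. -/
theorem exists_subseq_tendsto (hν : NonDegenerate ν)
    (hinv : ¬ ∃ μ : ProbabilityMeasure S1, Preserves G (μ : Measure S1)) (φ : C(S1, ℝ)) :
    ∃ (ψ : C(S1, ℝ)) (k : ℕ → ℕ), StrictMono k ∧
      Tendsto (fun j => (avg ν (fwd G))^[k j] φ) atTop (𝓝 ψ) := by
  let I := ContinuousMap.isometryEquivBoundedOfCompact S1 ℝ
  have hK : IsCompact (closure (Set.range fun n => I ((avg ν (fwd G))^[n] φ))) := by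
    refine BoundedContinuousFunction.arzela_ascoli (Metric.closedBall 0 ‖φ‖)
      (isCompact_closedBall _ _) _ ?_ ?_
    · rintro f x ⟨n, rfl⟩
      rw [mem_closedBall_zero_iff]
      exact (ContinuousMap.norm_coe_le_norm _ x).trans (norm_iterate_avg_le ν _ φ n)
    · intro x
      rw [Metric.equicontinuousAt_iff]
      intro ε hε
      obtain ⟨δ, hδ, h⟩ := exists_equicontinuity hν hinv φ (half_pos hε)
      refine ⟨δ, hδ, fun y hy => ?_⟩
      rintro ⟨_, n, rfl⟩
      have := h n y x hy.le
      rw [dist_comm, Real.dist_eq]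
      exact this.trans_lt (half_lt_self hε)
  obtain ⟨f, -, k, hk, hf⟩ := hK.tendsto_subseq
    (x := fun n => I ((avg ν (fwd G))^[n] φ)) fun n => subset_closure ⟨n, rfl⟩
  refine ⟨I.symm f, k, hk, ?_⟩
  have := (I.symm.continuous.tendsto f).comp hf
  refine this.congr fun j => ?_
  exact I.symm_apply_apply _

/-- Two late terms of the subsequence differ by many iterations of `P`, so its limit is recurrent,
hence fixed. The distance of `P^n φ` to a fixed point does not increase, so closeness at one time
persists. -/
theorem exists_limit (hν : NonDegenerate ν)
    (hinv : ¬ ∃ μ : ProbabilityMeasure S1, Preserves G (μ : Measure S1))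
    (hind : Indecomposable ν) (φ : C(S1, ℝ)) :
    ∃ ψ : C(S1, ℝ), Tendsto (fun n => (avg ν (fwd G))^[n] φ) atTop (𝓝 ψ) := by
  obtain ⟨ψ, k, hk, hlim⟩ := exists_subseq_tendsto hν hinv φ
  set P := avg ν (fwd G)
  have hrec : IsRecurrent ν ψ := by
    intro ε hε N
    obtain ⟨J, hJ⟩ := Metric.tendsto_atTop.1 hlim (ε / 2) (half_pos hε)
    have h1 := hJ J le_rfl
    -- Chosen so that `k J' ≥ k J + N`, which makes the return time `k J' - k J` at least `N`.
    set J' := J + (k J + N)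
    have h2 := hJ J' (Nat.le_add_right _ _)
    have hk' : k J + N ≤ k J' := (Nat.le_add_left _ J).trans (hk.id_le J')
    refine ⟨k J' - k J, by omega, ?_⟩
    have h3 : P^[k J' - k J] (P^[k J] φ) = P^[k J'] φ := by
      rw [← Function.iterate_add_apply]
      congr 2
      omega
    have h4 := dist_iterate_avg_le ν (fwd G) ψ (P^[k J] φ) (k J' - k J)
    change dist (P^[k J' - k J] ψ) (P^[k J' - k J] (P^[k J] φ)) ≤ _ at h4
    rw [h3, dist_comm ψ] at h4
    have := dist_triangle (P^[k J' - k J] ψ) (P^[k J'] φ) ψ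
    change dist (P^[k J' - k J] ψ) ψ < ε
    linarith
  have hfix : P ψ = ψ := hrec.avg_eq hν hinv hind
  refine ⟨ψ, Metric.tendsto_atTop.2 fun ε hε => ?_⟩
  obtain ⟨J, hJ⟩ := Metric.tendsto_atTop.1 hlim ε hε
  refine ⟨k J, fun n hn => ?_⟩
  obtain ⟨m, rfl⟩ := Nat.exists_eq_add_of_le hn
  have h1 := dist_iterate_avg_le ν (fwd G) (P^[k J] φ) ψ m
  change dist (P^[m] (P^[k J] φ)) (P^[m] ψ) ≤ _ at h1
  rw [Function.iterate_fixed hfix, ← Function.iterate_add_apply, add_comm] at h1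
  exact h1.trans_lt (hJ J le_rfl)

end Convergence

/-! ### The path measure, laws of the walk and stationarity. -/

section Paths

variable {G : Subsemigroup HomeoS1} (ν : Measure G) [IsProbabilityMeasure ν]

/-- The path with first coordinate `q.1` followed by the path `q.2`. -/
def cons (q : G × (ℕ → G)) : ℕ → G := fun n => Nat.casesOn n q.1 q.2

theorem measurable_cons : Measurable (cons (G := G)) := by
  refine measurable_pi_lambda _ fun n => ?_
  cases n with
  | zero => exact measurable_fst
  | succ n => exact (measurable_pi_apply n).comp measurable_snd

theorem map_cons_pathMeasure : (ν.prod (pathMeasure ν)).map cons = pathMeasure ν := by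
  refine Measure.eq_infinitePi (fun _ : ℕ => ν) fun s t ht => ?_
  have ht' : ∀ i, MeasurableSet (if i ∈ s then t i else Set.univ) := fun i => by
    split_ifs
    exacts [ht i, MeasurableSet.univ]
  -- Padding with the full space gives a box over an initial segment of `ℕ`, from which the first
  -- coordinate splits off.
  set u : ℕ → Set G := fun i => if i ∈ s then t i else Set.univ with hu
  obtain ⟨N, hN⟩ := s.exists_nat_subset_range
  have h1 : Set.pi (s : Set ℕ) t = Set.pi (Finset.range (N + 1) : Set ℕ) u := by
    ext ω
    simp only [Set.mem_pi, Finset.mem_coe, hu]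
    refine ⟨fun h i _ => ?_, fun h i hi => ?_⟩
    · split_ifs with hi
      exacts [h i hi, trivial]
    · have := h i (Finset.range_mono (Nat.le_succ N) (hN hi))
      rwa [if_pos hi] at this
  have h2 : ∏ i ∈ s, ν (t i) = ∏ i ∈ Finset.range (N + 1), ν (u i) := by
    rw [← Finset.prod_subset (hN.trans (Finset.range_mono (Nat.le_succ N)))]
    · exact Finset.prod_congr rfl fun i hi => by simp [hu, hi]
    · intro i _ hi
      simp [hu, hi]
  have h3 : cons ⁻¹' Set.pi (Finset.range (N + 1) : Set ℕ) u
      = u 0 ×ˢ Set.pi (Finset.range N : Set ℕ) fun i => u (i + 1) := by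
    ext ⟨g, ω⟩
    simp only [Set.mem_preimage, Set.mem_pi, Finset.mem_coe, Finset.mem_range, Set.mem_prod]
    refine ⟨fun h => ⟨h 0 (Nat.succ_pos N), fun i hi => h (i + 1) (Nat.succ_lt_succ hi)⟩,
      fun h i hi => ?_⟩
    cases i with
    | zero => exact h.1
    | succ i => exact h.2 i (Nat.lt_of_succ_lt_succ hi)
  rw [h1, h2, Measure.map_apply measurable_cons
    (MeasurableSet.pi (Finset.countable_toSet _) fun i _ => ht' i), h3, Measure.prod_prod,
    pathMeasure, Measure.infinitePi_pi _ fun i _ => ht' (i + 1), Finset.prod_range_succ', mul_comm]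

theorem walk_cons_succ (g : G) (ω : ℕ → G) (n : ℕ) :
    walk (cons (g, ω)) (n + 1) = walk ω n * (g : HomeoS1) := by
  induction n with
  | zero => rfl
  | succ n ih =>
    change (ω n : HomeoS1) * walk (cons (g, ω)) (n + 1) = (ω n : HomeoS1) * walk ω n * g
    rw [ih, mul_assoc]

/-- Conditioning on the first letter `g`, the walk from `x` becomes an independent walk from `g x`;
this matches the outermost `P` in `P (P^n φ)`. -/
theorem integral_law (n : ℕ) (x : S1) (φ : C(S1, ℝ)) :
    ∫ y, φ y ∂(law ν n x : Measure S1) = (avg ν (fwd G))^[n] φ x := by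
  have key : ∀ n x, ∫ y, φ y ∂(law ν n x : Measure S1) = ∫ ω, φ (walk ω n x) ∂pathMeasure ν :=
    fun n x => integral_map (measurable_walk_apply n x).aemeasurable
      φ.continuous.aestronglyMeasurable
  induction n generalizing x with
  | zero =>
    rw [key]
    change ∫ _ : ℕ → G, φ x ∂pathMeasure ν = φ x
    simp
  | succ n ih =>
    have hm : Measurable fun ω : ℕ → G => φ (walk ω (n + 1) x) :=
      φ.continuous.measurable.comp (measurable_walk_apply (n + 1) x)
    rw [key, ← map_cons_pathMeasure, integral_map measurable_cons.aemeasurable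
      hm.aestronglyMeasurable, integral_prod, Function.iterate_succ_apply', avg_apply]
    · refine integral_congr_ae (ae_of_all _ fun g => ?_)
      simp only [walk_cons_succ, fwd_apply]
      rw [← ih, key]
      rfl
    · exact Integrable.of_bound (C := ‖φ‖) (hm.comp measurable_cons).aestronglyMeasurable
        (ae_of_all _ fun _ => φ.norm_coe_le_norm _)

theorem measurable_skewProduct : Measurable (skewProduct G) := by
  refine Measurable.prodMk (measurable_pi_lambda _ fun n =>
    (measurable_pi_apply (n + 1)).comp measurable_fst) ?_
  have h : Measurable fun q : (ℕ → G) × S1 => (q.1 0, q.2) :=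
    ((measurable_pi_apply 0).comp measurable_fst).prodMk measurable_snd
  exact (fwd G).continuous.measurable.comp h

variable {ν} in
theorem isStationary_of_push_eq {μ : ProbabilityMeasure S1} (h : push ν (fwd G) μ = μ) :
    IsStationary ν (μ : Measure S1) := by
  refine ⟨measurable_skewProduct, ?_⟩
  have hf : Measurable (fwd G) := (fwd G).continuous.measurable
  have hc : Measurable (Prod.map (cons (G := G)) (id : S1 → S1)) :=
    measurable_cons.prodMap measurable_id
  have hpath : (pathMeasure ν).prod (μ : Measure S1)
      = ((ν.prod (pathMeasure ν)).prod (μ : Measure S1)).map (Prod.map cons id) := by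
    rw [← Measure.map_prod_map _ _ measurable_cons measurable_id, map_cons_pathMeasure,
      Measure.map_id]
  refine (Measure.prod_eq fun A B hA hB => ?_).symm
  have hμ : ∫⁻ g, (μ : Measure S1) ((g : HomeoS1) ⁻¹' B) ∂ν = (μ : Measure S1) B := by
    have h1 := congrArg (fun η : ProbabilityMeasure S1 => (η : Measure S1) B) h
    rw [coe_push, Measure.map_apply hf hB, Measure.prod_apply (hf hB)] at h1
    exact h1
  have hAB := measurable_skewProduct (G := G) (hA.prod hB)
  -- After the first letter is split off, the shifted path depends only on the tail and the moved
  -- point only on the first letter, so the measure of a rectangle factorises.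
  have hslice : ∀ p : G × (ℕ → G), (μ : Measure S1)
      (Prod.mk p ⁻¹' (Prod.map cons id ⁻¹' (skewProduct G ⁻¹' A ×ˢ B)))
      = (μ : Measure S1) ((p.1 : HomeoS1) ⁻¹' B) * A.indicator 1 p.2 := by
    rintro ⟨g, ω⟩
    by_cases hω : ω ∈ A
    · rw [Set.indicator_of_mem hω, Pi.one_apply, mul_one]
      congr 1
      ext x
      exact and_iff_right hω
    · rw [Set.indicator_of_notMem hω, mul_zero]
      refine measure_mono_null (t := ∅) (fun x hx => ?_) measure_empty
      exact (hω hx.1).elim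
  have hm : Measurable fun g : G => (μ : Measure S1) ((g : HomeoS1) ⁻¹' B) :=
    measurable_measure_prodMk_left (hf hB)
  rw [Measure.map_apply measurable_skewProduct (hA.prod hB), hpath, Measure.map_apply hc hAB,
    Measure.prod_apply (hc hAB), lintegral_congr hslice,
    lintegral_prod_mul hm.aemeasurable (measurable_one.indicator hA).aemeasurable, hμ,
    lintegral_indicator_one hA, mul_comm]

/-- A pointwise limit of the laws of the random walk is represented by a measure. -/
theorem exists_integral_eq_limit (x : S1) (c : C(S1, ℝ) → ℝ)
    (hc : ∀ φ : C(S1, ℝ), Tendsto (fun n => (avg ν (fwd G))^[n] φ x) atTop (𝓝 (c φ))) :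
    ∃ μ : ProbabilityMeasure S1, ∀ φ : C(S1, ℝ), ∫ y, φ y ∂(μ : Measure S1) = c φ := by
  -- Compactness along an ultrafilter supplies the measure; the assumed limits then determine its
  -- integrals.
  let U : Ultrafilter ℕ := hyperfilter ℕ
  obtain ⟨μ, -, hμ⟩ := isCompact_univ.ultrafilter_le_nhds (U.map fun n => law ν n x) (by simp)
  have hμ' : Tendsto (fun n => law ν n x) U (𝓝 μ) := hμ
  refine ⟨μ, fun φ => tendsto_nhds_unique (((tendsto_probabilityMeasure_iff.1 hμ') φ).congr
    fun n => integral_law ν n x φ) ((hc φ).mono_left Nat.hyperfilter_le_atTop)⟩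

end Paths

end CircleWalk
theorem mainTheorem4 (G : Subsemigroup CircleWalk.HomeoS1) (ν : Measure G)
    [IsProbabilityMeasure ν] (hν : CircleWalk.NonDegenerate ν)
    (hinv : ¬ ∃ μ : ProbabilityMeasure CircleWalk.S1, CircleWalk.Preserves G (μ : Measure CircleWalk.S1))
    (hind : CircleWalk.Indecomposable ν) :
    ∃ μ : CircleWalk.S1 → ProbabilityMeasure CircleWalk.S1,
      (∀ x, CircleWalk.IsStationary ν (μ x : Measure CircleWalk.S1)) ∧
      (∀ x, Tendsto (fun n => CircleWalk.law ν n x) atTop (𝓝 (μ x))) ∧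
      ∀ φ : C(CircleWalk.S1, ℝ),
        Tendsto (fun n : ℕ => ⨆ x : CircleWalk.S1,
          |∫ y, φ y ∂(CircleWalk.law ν n x : Measure CircleWalk.S1) - ∫ y, φ y ∂(μ x : Measure CircleWalk.S1)|)
          atTop (𝓝 0) := by
  choose ψ hψ using CircleWalk.exists_limit hν hinv hind
  have hx : ∀ φ x, Tendsto (fun n => (CircleWalk.avg ν (CircleWalk.fwd G))^[n] φ x) atTop
      (𝓝 (ψ φ x)) := fun φ x =>
    ((continuous_eval_const x).tendsto (ψ φ)).comp (hψ φ)
  choose μ hμ using fun x => CircleWalk.exists_integral_eq_limit ν x (fun φ => ψ φ x)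
    fun φ => hx φ x
  refine ⟨μ, fun x => ?_, fun x => ?_, fun φ => ?_⟩
  · refine CircleWalk.isStationary_of_push_eq (CircleWalk.probabilityMeasure_ext fun φ => ?_)
    rw [CircleWalk.integral_push, hμ, hμ]
    -- Replacing `φ` by `P φ` only shifts the sequence by one step, so the limit measures are
    -- stationary.
    refine tendsto_nhds_unique (hx (CircleWalk.avg ν (CircleWalk.fwd G) φ) x) ?_
    exact (hx φ x).comp (tendsto_add_atTop_nat 1)
  · refine CircleWalk.tendsto_probabilityMeasure_iff.2 fun φ => ?_
    simp only [CircleWalk.integral_law, hμ]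
    exact hx φ x
  · have h := tendsto_iff_dist_tendsto_zero.1 (hψ φ)
    -- The supremum is dominated by the uniform distance between `P^n φ` and its limit.
    refine squeeze_zero (fun n => Real.iSup_nonneg fun x => abs_nonneg _)
      (fun n => ciSup_le fun x => ?_) h
    rw [CircleWalk.integral_law, hμ, ← Real.dist_eq]
    exact ContinuousMap.dist_apply_le_dist x
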